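/- Let $M$ be a smooth ($C^\infty$, Hausdorff, second countable, without boundary) oriented Riemannian manifold of dimension 3 with $H^1_{dR}(M)=0$, i.e. every smooth closed 1-form on $M$ is the differential of a smooth function. Let $\mu$ be its Riemannian volume form and let $\langle\cdot,\cdot\rangle$ be the metric on covectors. For a smooth function $f$ let $\nabla f$ be its gradient and $\Delta f=-\operatorname{div}(\nabla f)$ the (nonnegative) Laplacian. A smooth bivector field $\pi$ on $M$ is called a Killing–Poisson tensor if 1. the bracket $\{a,b\}=\pi(da,db)$ on $C^\infty(M)$ satisfies the Jacobi identity (that is, $\pi$ is a Poisson tensor); 2. $\operatorname{div}\pi=0$, where $\operatorname{div}\pi$ is the contraction of the covariant derivative of $\pi$ with respect to the Levi-Civita connection; 3. $L_{\nabla f}\pi=0$ on $U$ for every open $U\subset M$ and every $f\in C^\infty(U)$ with $\pi(df,\cdot)=0$ on $U$. Let $\pi$ be a smooth bivector field on $M$, and let $i_\pi\mu$ be the 1-form depending linearly on $\pi$ with $i_{X\wedge Y}\mu=\mu(X,Y,\cdot)$. Then $\pi$ is a Killing–Poisson tensor if and only if there exists $f\in C^\infty(M)$ such that $$i_\pi\mu=df\qquad\text{and}\qquad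 d\langle df,df\rangle+\Delta(f)\,df=0 .$$ -/

import Mathlib

open Set Bundle Manifold Topology
open scoped ContDiff

noncomputable section

namespace KillingPoisson

/-- The model space `ℝ³`. -/
abbrev R3 : Type := EuclideanSpace ℝ (Fin 3)

/-- The `i`-th standard basis vector of `ℝ³`. -/
def e (i : Fin 3) : R3 := EuclideanSpace.single i 1

section Manifold

variable {M : Type*} [TopologicalSpace M] [ChartedSpace R3 M]

/-! ### Functions, one-forms, vector fields -/

/-- The differential `df_x : T_x M → ℝ` of a real function at a point. -/
def d (f : M → ℝ) (x : M) : TangentSpace (𝓡 3) x →L[ℝ] ℝ := mvfderiv (𝓡 3) f x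

/-- `f` is of class `C^∞` on `U`. -/
def SmoothOn (f : M → ℝ) (U : Set M) : Prop := ContMDiffOn (𝓡 3) 𝓘(ℝ, ℝ) ∞ f U

/-- `f ∈ C^∞(M)`. -/
def Smooth (f : M → ℝ) : Prop := ContMDiff (𝓡 3) 𝓘(ℝ, ℝ) ∞ f

/-- A (not necessarily smooth) one-form. -/
abbrev OneForm (M : Type*) [TopologicalSpace M] [ChartedSpace R3 M] : Type _ :=
  ∀ x : M, TangentSpace (𝓡 3) x →L[ℝ] ℝ

/-- A (not necessarily smooth) vector field. -/
abbrev VectorField (M : Type*) [TopologicalSpace M] [ChartedSpace R3 M] : Type _ :=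
  ∀ x : M, TangentSpace (𝓡 3) x

/-- The action `X(f) = df(X)` of a vector field on a function. -/
def act (X : VectorField M) (f : M → ℝ) (x : M) : ℝ := d f x (X x)

/-! ### Coordinates

For `p : M`, `extChartAt (𝓡 3) p` is the preferred chart at `p`, with values in `ℝ³`. Points of
its domain are described by `u` in its target. -/

/-- The point of `M` with coordinates `u` in the chart at `p`. -/
def pt (p : M) (u : R3) : M := (extChartAt (𝓡 3) p).symm u

/-- The derivative at `u` of the inverse of the chart at `p`; it sends the `i`-th standard basis
vector to the coordinate vector field `∂_i`. -/
def frameMap (p : M) (u : R3) : R3 →L[ℝ] TangentSpace (𝓡 3) (pt p u) :=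
  mfderiv 𝓘(ℝ, R3) (𝓡 3) (extChartAt (𝓡 3) p).symm u

/-- The coordinate vector `∂_i` of the chart at `p`, at the point with coordinates `u`. -/
def frame (p : M) (u : R3) (i : Fin 3) : TangentSpace (𝓡 3) (pt p u) := frameMap p u (e i)

/-- The `i`-th coordinate function of the chart at `p`. -/
def coord (p : M) (i : Fin 3) (y : M) : ℝ := extChartAt (𝓡 3) p y i

/-- The coordinate covector `dx_i` of the chart at `p`, at the point with coordinates `u`. -/
def coframe (p : M) (u : R3) (i : Fin 3) : TangentSpace (𝓡 3) (pt p u) →L[ℝ] ℝ :=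
  d (coord p i) (pt p u)

/-- The partial derivative `∂_i F (u)` of a function of the coordinates. -/
def pderiv (i : Fin 3) (F : R3 → ℝ) (u : R3) : ℝ := fderiv ℝ F u (e i)

/-! ### First de Rham cohomology -/

/-- Smoothness of a one-form, as a section of the cotangent bundle. -/
def OneForm.IsSmooth [IsManifold (𝓡 3) ∞ M] (α : OneForm M) : Prop :=
  ContMDiff (𝓡 3) ((𝓡 3).prod 𝓘(ℝ, R3 →L[ℝ] ℝ)) ∞
    (fun x ↦ TotalSpace.mk' (R3 →L[ℝ] ℝ) x (α x))

/-- The expression of a one-form in the chart at `p` (its pullback to `ℝ³`). -/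
def OneForm.inChart (α : OneForm M) (p : M) (u : R3) : R3 →L[ℝ] ℝ :=
  (α (pt p u)).comp (frameMap p u)

/-- The exterior derivative `dα_x(v, w) = (D_v α)(w) - (D_w α)(v)`, computed in the chart at `x`.
(The tangent space `T_x M` is by definition `ℝ³` through that chart.) -/
def OneForm.extDeriv (α : OneForm M) (x : M) (v w : TangentSpace (𝓡 3) x) : ℝ :=
  fderiv ℝ (α.inChart x) (extChartAt (𝓡 3) x x) v w
    - fderiv ℝ (α.inChart x) (extChartAt (𝓡 3) x x) w v

/-- The one-form is closed: `dα = 0`. -/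
def OneForm.IsClosed (α : OneForm M) : Prop := ∀ x v w, α.extDeriv x v w = 0

/-- The one-form is exact: `α = df` with `f ∈ C^∞(M)`. -/
def OneForm.IsExact (α : OneForm M) : Prop := ∃ f : M → ℝ, Smooth f ∧ ∀ x, α x = d f x

variable (M) in
/-- `H¹_dR(M) = 0`: every smooth closed one-form on `M` is exact. -/
def FirstDeRhamVanishes [IsManifold (𝓡 3) ∞ M] : Prop :=
  ∀ α : OneForm M, α.IsSmooth → α.IsClosed → α.IsExact

/-! ### Bivector fields -/

/-- The value `b(α, β)` of a bivector `b ∈ ⋀² T_x M` on two covectors: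
`(v ∧ w)(α, β) = α(v) β(w) - α(w) β(v)`. -/
def evalBivector {x : M} (b : ⋀[ℝ]^2 (TangentSpace (𝓡 3) x))
    (α β : TangentSpace (𝓡 3) x →L[ℝ] ℝ) : ℝ :=
  exteriorPower.pairingDual ℝ (TangentSpace (𝓡 3) x) 2
    (exteriorPower.ιMulti ℝ 2 ![(α : TangentSpace (𝓡 3) x →ₗ[ℝ] ℝ), (β : _ →ₗ[ℝ] ℝ)]) b

variable (M) in
/-- A smooth bivector field: `π_x ∈ ⋀² T_x M`, depending smoothly on `x`, in the sense that
`π(da, db)` is smooth on `U` for all smooth functions `a`, `b` on an open set `U`. -/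
structure BivectorField where
  val : ∀ x : M, ⋀[ℝ]^2 (TangentSpace (𝓡 3) x)
  smooth : ∀ (U : Set M), IsOpen U → ∀ a b : M → ℝ, SmoothOn a U → SmoothOn b U →
    SmoothOn (fun x ↦ evalBivector (val x) (d a x) (d b x)) U

namespace BivectorField

variable (P : BivectorField M)

/-- `π_x(α, β)` for covectors `α`, `β` at `x`. -/
def eval (x : M) (α β : TangentSpace (𝓡 3) x →L[ℝ] ℝ) : ℝ := evalBivector (P.val x) α β

/-- The bracket `{a, b} = π(da, db)`. -/
def bracket (a b : M → ℝ) (x : M) : ℝ := P.eval x (d a x) (d b x)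

/-- `π` is a Poisson tensor: its bracket satisfies the Jacobi identity on `C^∞(M)`. (Bilinearity,
antisymmetry and the Leibniz rule are automatic.) -/
def IsPoisson : Prop :=
  ∀ a b c : M → ℝ, Smooth a → Smooth b → Smooth c → ∀ x,
    P.bracket a (P.bracket b c) x + P.bracket b (P.bracket c a) x
      + P.bracket c (P.bracket a b) x = 0

/-- `f` is a Casimir function on `U`: `i_{df} π = 0` on `U`. -/
def IsCasimirOn (f : M → ℝ) (U : Set M) : Prop :=
  ∀ x ∈ U, ∀ β : TangentSpace (𝓡 3) x →L[ℝ] ℝ, P.eval x (d f x) β = 0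

/-- The Lie derivative of `π` along `X`, evaluated on exact one-forms:
`(L_X π)(da, db) = X(π(da, db)) - π(L_X da, db) - π(da, L_X db)` with `L_X da = d(X(a))`. -/
def lieDeriv (X : VectorField M) (a b : M → ℝ) (x : M) : ℝ :=
  act X (P.bracket a b) x - P.eval x (d (act X a) x) (d b x) - P.eval x (d a x) (d (act X b) x)

/-- `L_X π = 0` on the open set `U`. -/
def LieDerivVanishesOn (X : VectorField M) (U : Set M) : Prop :=
  ∀ a b : M → ℝ, SmoothOn a U → SmoothOn b U → ∀ x ∈ U, P.lieDeriv X a b x = 0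

/-- The component `π^{ij} = π(dx_i, dx_j)` in the chart at `p`. -/
def comp (p : M) (i j : Fin 3) (u : R3) : ℝ := P.eval (pt p u) (coframe p u i) (coframe p u j)

end BivectorField

/-! ### Riemannian notions -/

section Riemannian

variable [RiemannianBundle (fun x : M ↦ TangentSpace (𝓡 3) x)]

/-- The matrix `g_{ij} = g(∂_i, ∂_j)` of the metric in the chart at `p`. -/
def metricMatrix (p : M) (u : R3) : Matrix (Fin 3) (Fin 3) ℝ :=
  Matrix.of fun i j ↦ inner ℝ (frame p u i) (frame p u j)

/-- The Christoffel symbols `Γ^k_{ij}` of the Levi-Civita connection in the chart at `p`: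
`∇_{∂_i} ∂_j = ∑_k Γ^k_{ij} ∂_k`. -/
def christoffel (p : M) (u : R3) (k i j : Fin 3) : ℝ :=
  (1 / 2 : ℝ) * ∑ l, (metricMatrix p u)⁻¹ k l *
    (pderiv i (fun u' ↦ metricMatrix p u' j l) u + pderiv j (fun u' ↦ metricMatrix p u' i l) u
      - pderiv l (fun u' ↦ metricMatrix p u' i j) u)

/-- The component `X^i = dx_i(X)` in the chart at `p`. -/
def vecComp (X : VectorField M) (p : M) (i : Fin 3) (u : R3) : ℝ := coframe p u i (X (pt p u))

/-- The component `(∇_{∂_l} X)^i` of the Levi-Civita covariant derivative of a vector field. -/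
def covDerivVec (X : VectorField M) (p : M) (u : R3) (l i : Fin 3) : ℝ :=
  pderiv l (vecComp X p i) u + ∑ k, christoffel p u i l k * vecComp X p k u

/-- The component `(∇_{∂_l} π)^{ij}` of the Levi-Civita covariant derivative of a bivector field. -/
def covDerivBivec (P : BivectorField M) (p : M) (u : R3) (l i j : Fin 3) : ℝ :=
  pderiv l (P.comp p i j) u + ∑ k, christoffel p u i l k * P.comp p k j u
    + ∑ k, christoffel p u j l k * P.comp p i k u

/-- The divergence of a vector field at `x`: the trace of `∇X`, computed in the chart at `x`. -/
def divVec (X : VectorField M) (x : M) : ℝ :=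
  ∑ i, covDerivVec X x (extChartAt (𝓡 3) x x) i i

/-- The component `(div π)^j` at `x`, where `div π` is the contraction of `∇π`, computed in the
chart at `x`. -/
def divBivec (P : BivectorField M) (x : M) (j : Fin 3) : ℝ :=
  ∑ i, covDerivBivec P x (extChartAt (𝓡 3) x x) i i j

/-- The isomorphism `# : T_x^* M → T_x M` given by the metric: `g(#α, v) = α(v)`. -/
def sharp {x : M} (α : TangentSpace (𝓡 3) x →L[ℝ] ℝ) : TangentSpace (𝓡 3) x :=
  haveI : FiniteDimensional ℝ (TangentSpace (𝓡 3) x) := inferInstanceAs (FiniteDimensional ℝ R3)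
  haveI : CompleteSpace (TangentSpace (𝓡 3) x) := FiniteDimensional.complete ℝ _
  (InnerProductSpace.toDual ℝ (TangentSpace (𝓡 3) x)).symm α

/-- The metric on covectors: `⟨α, β⟩ = g(#α, #β)`. -/
def coInner {x : M} (α β : TangentSpace (𝓡 3) x →L[ℝ] ℝ) : ℝ := inner ℝ (sharp α) (sharp β)

/-- The gradient vector field `∇f`. -/
def grad (f : M → ℝ) : VectorField M := fun x ↦ sharp (d f x)

/-- The (positive, Hodge) Laplace-Beltrami operator on functions, `Δ f = δ(df) = - div (∇f)`. -/
def laplacian (f : M → ℝ) (x : M) : ℝ := - divVec (grad f) x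

/-- A Killing-Poisson tensor: a Poisson tensor with vanishing divergence with respect to the
Levi-Civita connection, such that `L_{∇f} π = 0` on `U` for every open `U` and every Casimir
function `f ∈ C^∞(U)`. -/
structure IsKillingPoisson (P : BivectorField M) : Prop where
  poisson : P.IsPoisson
  div_eq_zero : ∀ x j, divBivec P x j = 0
  casimir : ∀ (U : Set M), IsOpen U → ∀ f : M → ℝ, SmoothOn f U → P.IsCasimirOn f U →
    P.LieDerivVanishesOn (grad f) U

end Riemannian

/-! ### Orientation and volume form -/

variable (M) in
/-- An orientation of `M`: orientations of the tangent spaces, locally constant in the local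
trivializations of the tangent bundle. -/
structure ManifoldOrientation [IsManifold (𝓡 3) ∞ M] where
  at_ : ∀ x : M, Orientation ℝ (TangentSpace (𝓡 3) x) (Fin 3)
  locally_constant : ∀ p : M, ∃ o₀ : Orientation ℝ R3 (Fin 3), ∀ᶠ y in 𝓝 p,
    ∀ hy : y ∈ (trivializationAt R3 (TangentSpace (𝓡 3)) p).baseSet,
      Orientation.map (Fin 3)
        ((trivializationAt R3 (TangentSpace (𝓡 3)) p).continuousLinearEquivAt
          ℝ y hy).toLinearEquiv (at_ y) = o₀

variable [IsManifold (𝓡 3) ∞ M] [RiemannianBundle (fun x : M ↦ TangentSpace (𝓡 3) x)]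

/-- The Riemannian volume form `μ` of an oriented Riemannian 3-manifold. -/
def volumeForm (o : ManifoldOrientation M) (x : M) :
    TangentSpace (𝓡 3) x [⋀^Fin 3]→ₗ[ℝ] ℝ :=
  haveI : Fact (Module.finrank ℝ (TangentSpace (𝓡 3) x) = 3) :=
    ⟨finrank_euclideanSpace_fin (𝕜 := ℝ) (n := 3)⟩
  (o.at_ x).volumeForm

/-- The one-form `i_π μ`, characterized by linearity in `π` and `i_{X ∧ Y} μ = μ(X, Y, ·)`.
(`curryLeft v` is `(X, Y) ↦ μ(v, X, Y) = μ(X, Y, v)`.) -/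
def contractVolume (o : ManifoldOrientation M) (P : BivectorField M) (x : M)
    (v : TangentSpace (𝓡 3) x) : ℝ :=
  exteriorPower.alternatingMapLinearEquiv ((volumeForm o x).curryLeft v) (P.val x)

end Manifold

end KillingPoisson

end

open KillingPoisson

namespace KillingPoisson

section Chart

variable {M : Type*} [TopologicalSpace M] [ChartedSpace R3 M]

lemma pt_mem_source {p : M} {u : R3} (hu : u ∈ (extChartAt (𝓡 3) p).target) :
    pt p u ∈ (extChartAt (𝓡 3) p).source :=
  (extChartAt (𝓡 3) p).map_target hu

lemma pt_mem_chart_source {p : M} {u : R3} (hu : u ∈ (extChartAt (𝓡 3) p).target) :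
    pt p u ∈ (chartAt R3 p).source := by
  rw [← extChartAt_source (I := 𝓡 3)]
  exact pt_mem_source hu

lemma extChartAt_pt {p : M} {u : R3} (hu : u ∈ (extChartAt (𝓡 3) p).target) :
    extChartAt (𝓡 3) p (pt p u) = u :=
  (extChartAt (𝓡 3) p).right_inv hu

lemma pt_extChartAt {p y : M} (hy : y ∈ (extChartAt (𝓡 3) p).source) :
    pt p (extChartAt (𝓡 3) p y) = y :=
  (extChartAt (𝓡 3) p).left_inv hy

@[simp] lemma pt_self (x : M) : pt x (extChartAt (𝓡 3) x x) = x :=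
  pt_extChartAt (mem_extChartAt_source x)

lemma continuousAt_pt {p : M} {u : R3} (hu : u ∈ (extChartAt (𝓡 3) p).target) :
    ContinuousAt (pt p) u :=
  continuousAt_extChartAt_symm'' hu

lemma target_mem_nhds {p : M} {u : R3} (hu : u ∈ (extChartAt (𝓡 3) p).target) :
    (extChartAt (𝓡 3) p).target ∈ 𝓝 u :=
  (isOpen_extChartAt_target p).mem_nhds hu

variable [IsManifold (𝓡 3) ∞ M]

lemma mdifferentiableAt_pt {p : M} {u : R3} (hu : u ∈ (extChartAt (𝓡 3) p).target) :
    MDifferentiableAt 𝓘(ℝ, R3) (𝓡 3) (extChartAt (𝓡 3) p).symm u :=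
  mdifferentiableWithinAt_univ.1
    (by simpa using mdifferentiableWithinAt_extChartAt_symm (I := 𝓡 3) hu)

lemma contMDiffAt_pt {p : M} {u : R3} (hu : u ∈ (extChartAt (𝓡 3) p).target) :
    ContMDiffAt 𝓘(ℝ, R3) (𝓡 3) ∞ (pt p) u :=
  (contMDiffOn_extChartAt_symm p).contMDiffAt (target_mem_nhds hu)

lemma frameMap_comp_mfderiv {p : M} {u : R3} (hu : u ∈ (extChartAt (𝓡 3) p).target) :
    frameMap p u ∘L (mfderiv (𝓡 3) 𝓘(ℝ, R3) (extChartAt (𝓡 3) p) (pt p u)) =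
      ContinuousLinearMap.id ℝ (TangentSpace (𝓡 3) (pt p u)) := by
  have h := mfderivWithin_extChartAt_symm_comp_mfderiv_extChartAt (I := 𝓡 3) hu
  simp only [modelWithCornersSelf_coe, range_id, mfderivWithin_univ] at h
  exact h

lemma d_frameMap {p : M} {u : R3} (hu : u ∈ (extChartAt (𝓡 3) p).target) {a : M → ℝ}
    (ha : MDifferentiableAt (𝓡 3) 𝓘(ℝ, ℝ) a (pt p u)) (w : R3) :
    d a (pt p u) (frameMap p u w) = fderiv ℝ (a ∘ pt p) u w := by
  have h := mfderiv_comp (I := 𝓘(ℝ, R3)) (I' := 𝓡 3) (I'' := 𝓘(ℝ, ℝ))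
    (f := (extChartAt (𝓡 3) p).symm) (g := a) u ha (mdifferentiableAt_pt hu)
  rw [mfderiv_eq_fderiv] at h
  exact (congrArg (fun L : R3 →L[ℝ] ℝ ↦ L w) h).symm

lemma coframe_frameMap {p : M} {u : R3} (hu : u ∈ (extChartAt (𝓡 3) p).target) (i : Fin 3)
    (w : R3) : coframe p u i (frameMap p u w) = w i := by
  have hc : MDifferentiableAt (𝓡 3) 𝓘(ℝ, ℝ) (coord p i) (pt p u) := by
    have h1 : MDifferentiableAt 𝓘(ℝ, R3) 𝓘(ℝ, ℝ) (EuclideanSpace.proj (𝕜 := ℝ) i : R3 →L[ℝ] ℝ)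
        (extChartAt (𝓡 3) p (pt p u)) :=
      (EuclideanSpace.proj (𝕜 := ℝ) i : R3 →L[ℝ] ℝ).differentiableAt.mdifferentiableAt
    exact h1.comp (pt p u) (mdifferentiableAt_extChartAt (pt_mem_chart_source hu))
  rw [coframe, d_frameMap hu hc]
  have he : coord p i ∘ pt p =ᶠ[𝓝 u] (EuclideanSpace.proj (𝕜 := ℝ) i : R3 →L[ℝ] ℝ) := by
    filter_upwards [target_mem_nhds hu] with v hv
    simp only [Function.comp_apply, coord]
    rw [extChartAt_pt hv]
    rfl
  rw [he.fderiv_eq, ContinuousLinearMap.fderiv]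
  simp

lemma d_frame {p : M} {u : R3} (hu : u ∈ (extChartAt (𝓡 3) p).target) {a : M → ℝ}
    (ha : MDifferentiableAt (𝓡 3) 𝓘(ℝ, ℝ) a (pt p u)) (i : Fin 3) :
    d a (pt p u) (frame p u i) = pderiv i (a ∘ pt p) u :=
  d_frameMap hu ha _

lemma coframe_frame {p : M} {u : R3} (hu : u ∈ (extChartAt (𝓡 3) p).target) (i j : Fin 3) :
    coframe p u i (frame p u j) = if i = j then 1 else 0 := by
  rw [frame, coframe_frameMap hu, e, PiLp.single_apply]

lemma sum_coframe_smul_frame {p : M} {u : R3} (hu : u ∈ (extChartAt (𝓡 3) p).target)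
    (v : TangentSpace (𝓡 3) (pt p u)) : ∑ i, coframe p u i v • frame p u i = v := by
  obtain ⟨w, rfl⟩ : ∃ w, frameMap p u w = v :=
    ⟨_, congrArg (fun L : TangentSpace (𝓡 3) (pt p u) →L[ℝ] TangentSpace (𝓡 3) (pt p u) ↦ L v)
      (frameMap_comp_mfderiv hu)⟩
  have hw : w = ∑ i, w i • e i := by
    ext j
    simp [e, Fin.sum_univ_three, PiLp.single_apply]
    fin_cases j <;> simp
  conv_rhs => rw [hw]
  simp only [coframe_frameMap hu, frame, map_sum, map_smul]

/-- The coordinate frame as a basis of the tangent space. -/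
noncomputable def frameBasis {p : M} {u : R3} (hu : u ∈ (extChartAt (𝓡 3) p).target) :
    Module.Basis (Fin 3) ℝ (TangentSpace (𝓡 3) (pt p u)) :=
  Module.Basis.ofEquivFun
    { toFun := fun v i ↦ coframe p u i v
      invFun := fun c ↦ ∑ i, c i • frame p u i
      map_add' := fun v w ↦ by ext; simp
      map_smul' := fun c v ↦ by ext; simp
      left_inv := sum_coframe_smul_frame hu
      right_inv := fun c ↦ by
        ext j
        simp [coframe_frame hu] }

@[simp] lemma frameBasis_apply {p : M} {u : R3} (hu : u ∈ (extChartAt (𝓡 3) p).target)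
    (i : Fin 3) : frameBasis hu i = frame p u i := by
  rw [frameBasis, Module.Basis.coe_ofEquivFun]
  change ∑ j, (Pi.single i (1 : ℝ) : Fin 3 → ℝ) j • frame p u j = frame p u i
  simp [Pi.single_apply]

lemma covector_ext {p : M} {u : R3} (hu : u ∈ (extChartAt (𝓡 3) p).target)
    {α β : TangentSpace (𝓡 3) (pt p u) →L[ℝ] ℝ}
    (h : ∀ i, α (frame p u i) = β (frame p u i)) : α = β := by
  ext v
  rw [← sum_coframe_smul_frame hu v]
  simp [h]

/-- A smooth function near `pt p u`, read in the chart. -/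
lemma contDiffAt_comp_pt {p : M} {u : R3} (hu : u ∈ (extChartAt (𝓡 3) p).target) {a : M → ℝ}
    (ha : ContMDiffAt (𝓡 3) 𝓘(ℝ, ℝ) ∞ a (pt p u)) : ContDiffAt ℝ ∞ (a ∘ pt p) u :=
  (ha.comp u (contMDiffAt_pt hu)).contDiffAt

lemma contMDiffAt_of_comp_pt {p : M} {u : R3} (hu : u ∈ (extChartAt (𝓡 3) p).target) {a : M → ℝ}
    (ha : ContDiffAt ℝ ∞ (a ∘ pt p) u) : ContMDiffAt (𝓡 3) 𝓘(ℝ, ℝ) ∞ a (pt p u) := by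
  have h1 : ContMDiffAt 𝓘(ℝ, R3) 𝓘(ℝ, ℝ) ∞ (a ∘ pt p) (extChartAt (𝓡 3) p (pt p u)) := by
    rw [extChartAt_pt hu]
    exact ha.contMDiffAt
  refine (h1.comp (pt p u)
    (contMDiffAt_extChartAt' (pt_mem_chart_source hu))).congr_of_eventuallyEq ?_
  filter_upwards [(isOpen_extChartAt_source (I := 𝓡 3) p).mem_nhds (pt_mem_source hu)] with y hy
  simp only [Function.comp_apply]
  rw [pt_extChartAt hy]

lemma smoothOn_coord (p : M) (i : Fin 3) : SmoothOn (coord p i) (extChartAt (𝓡 3) p).source := by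
  have h1 : ContMDiff 𝓘(ℝ, R3) 𝓘(ℝ, ℝ) ∞ (EuclideanSpace.proj (𝕜 := ℝ) i : R3 →L[ℝ] ℝ) :=
    (EuclideanSpace.proj (𝕜 := ℝ) i : R3 →L[ℝ] ℝ).contDiff.contMDiff
  rw [extChartAt_source]
  exact h1.comp_contMDiffOn contMDiffOn_extChartAt

end Chart
section Exterior

variable {V : Type*} [AddCommGroup V] [Module ℝ V]

lemma alternating_two_expand {N : Type*} [AddCommGroup N] [Module ℝ N]
    (A : V [⋀^Fin 2]→ₗ[ℝ] N) (v : Fin 3 → V) (x y : Fin 3 → ℝ) :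
    A ![∑ i, x i • v i, ∑ i, y i • v i] =
      (x 0 * y 1 - x 1 * y 0) • A ![v 0, v 1] + (x 0 * y 2 - x 2 * y 0) • A ![v 0, v 2] +
        (x 1 * y 2 - x 2 * y 1) • A ![v 1, v 2] := by
  have swap : ∀ a b : V, A ![a, b] = -A ![b, a] := fun a b ↦ by
    rw [← A.map_swap ![b, a] (i := 0) (j := 1) (by decide)]
    congr 1
    ext i
    fin_cases i <;> rfl
  have diag : ∀ a : V, A ![a, a] = 0 := fun a ↦
    A.map_eq_zero_of_eq ![a, a] (i := 0) (j := 1) rfl (by decide)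
  have add_left : ∀ a b c : V, A ![a + b, c] = A ![a, c] + A ![b, c] := fun a b c ↦
    A.toMultilinearMap.cons_add ![c] a b
  have smul_left : ∀ (r : ℝ) (a c : V), A ![r • a, c] = r • A ![a, c] := fun r a c ↦
    A.toMultilinearMap.cons_smul ![c] r a
  have add_right : ∀ a b c : V, A ![a, b + c] = A ![a, b] + A ![a, c] := fun a b c ↦ by
    rw [swap, add_left, swap b, swap c]
    module
  have smul_right : ∀ (r : ℝ) (a c : V), A ![a, r • c] = r • A ![a, c] := fun r a c ↦ by
    rw [swap, smul_left, swap c, smul_neg, neg_neg]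
  simp only [Fin.sum_univ_three, add_left, add_right, smul_left, smul_right, diag,
    swap (v 1) (v 0), swap (v 2) (v 0), swap (v 2) (v 1)]
  module

/-- The components of a bivector in a frame `v` with dual coframe `ξ` determine the value of every
linear functional on it. -/
lemma bivector_functional_eq (v : Fin 3 → V) (ξ : Fin 3 → Module.Dual ℝ V)
    (h : ∀ w, ∑ i, ξ i w • v i = w) (L : ⋀[ℝ]^2 V →ₗ[ℝ] ℝ) (b : ⋀[ℝ]^2 V) :
    L b =
      exteriorPower.pairingDual ℝ V 2 (exteriorPower.ιMulti ℝ 2 ![ξ 0, ξ 1]) b *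
          L (exteriorPower.ιMulti ℝ 2 ![v 0, v 1]) +
        exteriorPower.pairingDual ℝ V 2 (exteriorPower.ιMulti ℝ 2 ![ξ 0, ξ 2]) b *
          L (exteriorPower.ιMulti ℝ 2 ![v 0, v 2]) +
        exteriorPower.pairingDual ℝ V 2 (exteriorPower.ιMulti ℝ 2 ![ξ 1, ξ 2]) b *
          L (exteriorPower.ιMulti ℝ 2 ![v 1, v 2]) := by
  set q := fun i j ↦ exteriorPower.pairingDual ℝ V 2 (exteriorPower.ιMulti ℝ 2 ![ξ i, ξ j])
    with hq
  suffices hL : L = L (exteriorPower.ιMulti ℝ 2 ![v 0, v 1]) • q 0 1 +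
      L (exteriorPower.ιMulti ℝ 2 ![v 0, v 2]) • q 0 2 +
      L (exteriorPower.ιMulti ℝ 2 ![v 1, v 2]) • q 1 2 by
    conv_lhs => rw [hL]
    simp only [LinearMap.add_apply, LinearMap.smul_apply, smul_eq_mul, hq]
    ring
  refine exteriorPower.linearMap_ext ?_
  ext m
  obtain ⟨a, c, rfl⟩ : ∃ a c, m = ![a, c] := ⟨m 0, m 1, by ext i; fin_cases i <;> rfl⟩
  have hx := alternating_two_expand (L.compAlternatingMap (exteriorPower.ιMulti ℝ 2)) v
    (fun i ↦ ξ i a) (fun i ↦ ξ i c)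
  rw [h, h] at hx
  rw [hx]
  simp [hq, exteriorPower.pairingDual_ιMulti_ιMulti, Matrix.det_fin_two]
  ring

end Exterior

section Bivector

lemma evalBivector_ιMulti {M : Type*} [TopologicalSpace M] [ChartedSpace R3 M] {x : M}
    (v w : TangentSpace (𝓡 3) x)
    (α β : TangentSpace (𝓡 3) x →L[ℝ] ℝ) :
    evalBivector (exteriorPower.ιMulti ℝ 2 ![v, w]) α β = α v * β w - α w * β v := by
  rw [evalBivector, exteriorPower.pairingDual_ιMulti_ιMulti, Matrix.det_fin_two]
  simp [mul_comm]

variable {M : Type*} [TopologicalSpace M] [ChartedSpace R3 M] [IsManifold (𝓡 3) ∞ M]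
variable {p : M} {u : R3}

/-- A functional on bivectors in terms of the components in a chart. -/
lemma functional_eq_comp (hu : u ∈ (extChartAt (𝓡 3) p).target) (P : BivectorField M)
    (L : ⋀[ℝ]^2 (TangentSpace (𝓡 3) (pt p u)) →ₗ[ℝ] ℝ) :
    L (P.val (pt p u)) =
      P.comp p 0 1 u * L (exteriorPower.ιMulti ℝ 2 ![frame p u 0, frame p u 1]) +
        P.comp p 0 2 u * L (exteriorPower.ιMulti ℝ 2 ![frame p u 0, frame p u 2]) +
        P.comp p 1 2 u * L (exteriorPower.ιMulti ℝ 2 ![frame p u 1, frame p u 2]) :=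
  bivector_functional_eq (frame p u) (fun i ↦ (coframe p u i : TangentSpace (𝓡 3) (pt p u) →ₗ[ℝ] ℝ))
    (sum_coframe_smul_frame hu) L _

lemma eval_eq_comp (hu : u ∈ (extChartAt (𝓡 3) p).target) (P : BivectorField M)
    (α β : TangentSpace (𝓡 3) (pt p u) →L[ℝ] ℝ) :
    P.eval (pt p u) α β =
      P.comp p 0 1 u *
          (α (frame p u 0) * β (frame p u 1) - α (frame p u 1) * β (frame p u 0)) +
        P.comp p 0 2 u *
          (α (frame p u 0) * β (frame p u 2) - α (frame p u 2) * β (frame p u 0)) +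
        P.comp p 1 2 u *
          (α (frame p u 1) * β (frame p u 2) - α (frame p u 2) * β (frame p u 1)) := by
  simp only [← evalBivector_ιMulti]
  exact functional_eq_comp hu P _

lemma comp_antisymm (hu : u ∈ (extChartAt (𝓡 3) p).target) (P : BivectorField M) (i j : Fin 3) :
    P.comp p i j u = -P.comp p j i u := by
  rw [BivectorField.comp, BivectorField.comp, eval_eq_comp hu, eval_eq_comp hu]
  ring

lemma comp_self (hu : u ∈ (extChartAt (𝓡 3) p).target) (P : BivectorField M) (i : Fin 3) :
    P.comp p i i u = 0 := by
  linarith [comp_antisymm hu P i i]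

lemma contDiffAt_comp (hu : u ∈ (extChartAt (𝓡 3) p).target) (P : BivectorField M) (i j : Fin 3) :
    ContDiffAt ℝ ∞ (P.comp p i j) u := by
  have h := P.smooth _ (isOpen_extChartAt_source (I := 𝓡 3) p) _ _ (smoothOn_coord p i)
    (smoothOn_coord p j)
  exact contDiffAt_comp_pt hu (h.contMDiffAt
    ((isOpen_extChartAt_source (I := 𝓡 3) p).mem_nhds (pt_mem_source hu)))

end Bivector

section Gram

variable {E : Type*} [NormedAddCommGroup E] [InnerProductSpace ℝ E]

/-- The Gram matrix of a basis is the square of its coordinate matrix in an orthonormal basis. -/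
lemma det_gram_eq_sq {n : ℕ} (b : OrthonormalBasis (Fin n) ℝ E) (v : Fin n → E) :
    (Matrix.of fun i j ↦ inner ℝ (v i) (v j) : Matrix (Fin n) (Fin n) ℝ).det =
      b.toBasis.det v ^ 2 := by
  have h : (Matrix.of fun i j ↦ inner ℝ (v i) (v j) : Matrix (Fin n) (Fin n) ℝ) =
      (b.toBasis.toMatrix v).transpose * b.toBasis.toMatrix v := by
    ext i j
    rw [Matrix.of_apply, Matrix.mul_apply, ← b.sum_inner_mul_inner]
    refine Finset.sum_congr rfl fun k _ ↦ ?_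
    simp [Module.Basis.toMatrix_apply, b.repr_apply_apply, real_inner_comm]
  rw [h, Matrix.det_mul, Matrix.det_transpose, Module.Basis.det_apply, sq]

variable [Fact (Module.finrank ℝ E = 3)] (o : Orientation ℝ E (Fin 3))

lemma volumeForm_basis_sq (v : Fin 3 → E) :
    o.volumeForm v ^ 2 =
      (Matrix.of fun i j ↦ inner ℝ (v i) (v j) : Matrix (Fin 3) (Fin 3) ℝ).det := by
  set b := o.finOrthonormalBasis (by norm_num) Fact.out
  rw [det_gram_eq_sq b, o.volumeForm_robust b (o.finOrthonormalBasis_orientation _ _)]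

lemma volumeForm_basis_pos_iff (v : Module.Basis (Fin 3) ℝ E) :
    0 < o.volumeForm v ↔ v.orientation = o := by
  set b := o.finOrthonormalBasis (by norm_num) Fact.out
  have hb : b.toBasis.orientation = o := o.finOrthonormalBasis_orientation _ _
  rw [o.volumeForm_robust b hb, ← Module.Basis.orientation_eq_iff_det_pos, hb, eq_comm]

end Gram

lemma frame_eq_localFrame {M : Type*} [TopologicalSpace M] [ChartedSpace R3 M]
    [IsManifold (𝓡 3) ∞ M] {p : M} {u : R3} (hu : u ∈ (extChartAt (𝓡 3) p).target) (i : Fin 3) :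
    frame p u i = (trivializationAt R3 (TangentSpace (𝓡 3)) p).localFrame
      (EuclideanSpace.basisFun (Fin 3) ℝ).toBasis i (pt p u) := by
  have hb : pt p u ∈ (trivializationAt R3 (TangentSpace (𝓡 3)) p).baseSet := by
    rw [TangentBundle.trivializationAt_baseSet]
    exact pt_mem_chart_source hu
  rw [Trivialization.localFrame_apply_of_mem_baseSet _ _ hb]
  have h := TangentBundle.symmL_trivializationAt (𝕜 := ℝ) (I := 𝓡 3) (pt_mem_chart_source hu)
  rw [extChartAt_pt hu] at h
  simp only [modelWithCornersSelf_coe, range_id, mfderivWithin_univ] at h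
  have h2 := congrArg (fun L : R3 →L[ℝ] TangentSpace (𝓡 3) (pt p u) ↦ L (e i)) h
  refine h2.symm.trans ?_
  simp [Trivialization.basisAt, e, Trivialization.symmL_apply _ hb]

section Metric

variable {M : Type*} [TopologicalSpace M] [ChartedSpace R3 M]
  [RiemannianBundle (fun x : M ↦ TangentSpace (𝓡 3) x)]
variable {p : M} {u : R3}

lemma inner_sharp {x : M} (α : TangentSpace (𝓡 3) x →L[ℝ] ℝ) (v : TangentSpace (𝓡 3) x) :
    inner ℝ (sharp α) v = α v := by
  have : FiniteDimensional ℝ (TangentSpace (𝓡 3) x) := inferInstanceAs (FiniteDimensional ℝ R3)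
  have : CompleteSpace (TangentSpace (𝓡 3) x) := FiniteDimensional.complete ℝ _
  exact InnerProductSpace.toDual_symm_apply

lemma coInner_eq_apply_sharp {x : M} (α β : TangentSpace (𝓡 3) x →L[ℝ] ℝ) :
    coInner α β = α (sharp β) :=
  inner_sharp α _

lemma coInner_comm {x : M} (α β : TangentSpace (𝓡 3) x →L[ℝ] ℝ) :
    coInner α β = coInner β α :=
  real_inner_comm _ _

/-- The components `g^{ij}` of the metric on covectors in the chart at `p`. -/
noncomputable def cometric (p : M) (i j : Fin 3) (u : R3) : ℝ :=
  coInner (coframe p u i) (coframe p u j)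

lemma cometric_comm (p : M) (i j : Fin 3) : cometric p i j = cometric p j i :=
  funext fun _ ↦ coInner_comm _ _

lemma metricMatrix_comm (p : M) (u : R3) (i j : Fin 3) :
    metricMatrix p u i j = metricMatrix p u j i := by
  simp only [metricMatrix, Matrix.of_apply]
  exact real_inner_comm _ _

variable [IsManifold (𝓡 3) ∞ M]

lemma coframe_sharp (hu : u ∈ (extChartAt (𝓡 3) p).target)
    (β : TangentSpace (𝓡 3) (pt p u) →L[ℝ] ℝ) (i : Fin 3) :
    coframe p u i (sharp β) = ∑ j, cometric p i j u * β (frame p u j) := by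
  rw [← coInner_eq_apply_sharp, coInner_comm, coInner_eq_apply_sharp]
  conv_lhs => rw [← sum_coframe_smul_frame hu (sharp (coframe p u i))]
  rw [map_sum]
  refine Finset.sum_congr rfl fun j _ ↦ ?_
  rw [map_smul, smul_eq_mul, cometric_comm, cometric, coInner_eq_apply_sharp]

lemma metricMatrix_mul_cometric (hu : u ∈ (extChartAt (𝓡 3) p).target) :
    metricMatrix p u * Matrix.of (fun i j ↦ cometric p i j u) = 1 := by
  ext k j
  have h : inner ℝ (sharp (coframe p u j)) (frame p u k) = if j = k then (1 : ℝ) else 0 := by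
    rw [inner_sharp, coframe_frame hu]
  rw [← sum_coframe_smul_frame hu (sharp (coframe p u j)), sum_inner] at h
  rw [Matrix.mul_apply, Matrix.one_apply, if_congr eq_comm rfl rfl, ← h]
  refine Finset.sum_congr rfl fun i _ ↦ ?_
  rw [real_inner_smul_left, Matrix.of_apply, cometric, coInner_eq_apply_sharp,
    metricMatrix_comm, mul_comm]
  rfl

lemma cometric_eq_inv (hu : u ∈ (extChartAt (𝓡 3) p).target) (i j : Fin 3) :
    cometric p i j u = (metricMatrix p u)⁻¹ i j := by
  rw [Matrix.inv_eq_right_inv (metricMatrix_mul_cometric hu), Matrix.of_apply]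

lemma det_metricMatrix_ne_zero (hu : u ∈ (extChartAt (𝓡 3) p).target) :
    (metricMatrix p u).det ≠ 0 := by
  intro h
  have := congrArg Matrix.det (metricMatrix_mul_cometric hu)
  simp [h] at this

variable [IsContMDiffRiemannianBundle (𝓡 3) ∞ R3 (fun x : M ↦ TangentSpace (𝓡 3) x)]

lemma contDiffAt_metricMatrix (hu : u ∈ (extChartAt (𝓡 3) p).target) (i j : Fin 3) :
    ContDiffAt ℝ ∞ (fun w ↦ metricMatrix p w i j) u := by
  have hb : pt p u ∈ (trivializationAt R3 (TangentSpace (𝓡 3)) p).baseSet := by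
    rw [TangentBundle.trivializationAt_baseSet]
    exact pt_mem_chart_source hu
  have h1 := fun i ↦ contMDiffAt_localFrame_of_mem (I := 𝓡 3) (n := ∞)
    (trivializationAt R3 (TangentSpace (𝓡 3)) p) (EuclideanSpace.basisFun (Fin 3) ℝ).toBasis i hb
  have h2 := contDiffAt_comp_pt hu ((h1 i).inner_bundle (h1 j))
  refine h2.congr_of_eventuallyEq ?_
  filter_upwards [target_mem_nhds hu] with w hw
  simp only [metricMatrix, Matrix.of_apply, frame_eq_localFrame hw]
  rfl

lemma contDiffAt_det_metricMatrix (hu : u ∈ (extChartAt (𝓡 3) p).target) :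
    ContDiffAt ℝ ∞ (fun w ↦ (metricMatrix p w).det) u := by
  simp only [Matrix.det_fin_three]
  have h := contDiffAt_metricMatrix hu
  fun_prop (disch := assumption)

lemma contDiffAt_cometric (hu : u ∈ (extChartAt (𝓡 3) p).target) (i j : Fin 3) :
    ContDiffAt ℝ ∞ (cometric p i j) u := by
  have he : cometric p i j =ᶠ[𝓝 u]
      fun w ↦ ((metricMatrix p w).det)⁻¹ * (metricMatrix p w).adjugate i j := by
    filter_upwards [target_mem_nhds hu] with w hw
    rw [cometric_eq_inv hw, Matrix.inv_def]
    simp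
  refine ContDiffAt.congr_of_eventuallyEq ?_ he
  refine ((contDiffAt_det_metricMatrix hu).inv (det_metricMatrix_ne_zero hu)).mul ?_
  have h := contDiffAt_metricMatrix hu
  simp only [Matrix.adjugate_fin_three]
  fin_cases i <;> fin_cases j <;> simp <;> fun_prop (disch := assumption)

end Metric

section Volume

variable {M : Type*} [TopologicalSpace M] [ChartedSpace R3 M] [IsManifold (𝓡 3) ∞ M]
  [RiemannianBundle (fun x : M ↦ TangentSpace (𝓡 3) x)] (o : ManifoldOrientation M)
variable {p : M} {u : R3}

/-- The component `μ(∂_0, ∂_1, ∂_2)` of the volume form in the chart at `p`. -/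
noncomputable def volComp (p : M) (u : R3) : ℝ := volumeForm o (pt p u) (frame p u)

lemma volComp_sq (p : M) (u : R3) : volComp o p u ^ 2 = (metricMatrix p u).det := by
  have : Fact (Module.finrank ℝ (TangentSpace (𝓡 3) (pt p u)) = 3) :=
    ⟨finrank_euclideanSpace_fin (𝕜 := ℝ) (n := 3)⟩
  exact volumeForm_basis_sq (o.at_ (pt p u)) (frame p u)

lemma volComp_ne_zero (hu : u ∈ (extChartAt (𝓡 3) p).target) : volComp o p u ≠ 0 := by
  intro h
  apply det_metricMatrix_ne_zero hu
  rw [← volComp_sq o, h]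
  simp

lemma volComp_pos_iff (hu : u ∈ (extChartAt (𝓡 3) p).target) :
    0 < volComp o p u ↔ (frameBasis hu).orientation = o.at_ (pt p u) := by
  have : Fact (Module.finrank ℝ (TangentSpace (𝓡 3) (pt p u)) = 3) :=
    ⟨finrank_euclideanSpace_fin (𝕜 := ℝ) (n := 3)⟩
  have h := volumeForm_basis_pos_iff (o.at_ (pt p u)) (frameBasis hu)
  rw [show ⇑(frameBasis hu) = frame p u from funext (frameBasis_apply hu)] at h
  exact h

lemma volComp_eventually_sign (x : M) : ∃ s : ℝ, ∀ᶠ u in 𝓝 (extChartAt (𝓡 3) x x),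
    volComp o x u = s * √(metricMatrix x u).det := by
  obtain ⟨o₀, ho⟩ := o.locally_constant x
  have ht := target_mem_nhds (mem_extChartAt_target (I := 𝓡 3) x)
  have hc := continuousAt_pt (mem_extChartAt_target (I := 𝓡 3) x)
  have key : ∀ᶠ u in 𝓝 (extChartAt (𝓡 3) x x), 0 < volComp o x u ↔
      (EuclideanSpace.basisFun (Fin 3) ℝ).toBasis.orientation = o₀ := by
    rw [ContinuousAt, pt_self] at hc
    filter_upwards [ht, hc.eventually ho] with u hu hou
    have hb : pt x u ∈ (trivializationAt R3 (TangentSpace (𝓡 3)) x).baseSet := by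
      rw [TangentBundle.trivializationAt_baseSet]
      exact pt_mem_chart_source hu
    rw [volComp_pos_iff o hu, ← hou hb]
    rw [← (Orientation.map (Fin 3)
      ((trivializationAt R3 (TangentSpace (𝓡 3)) x).continuousLinearEquivAt
          ℝ _ hb).toLinearEquiv).injective.eq_iff, ← Module.Basis.orientation_map]
    have he : (frameBasis hu).map ((trivializationAt R3 (TangentSpace (𝓡 3))
        x).continuousLinearEquivAt ℝ _ hb).toLinearEquiv =
        (EuclideanSpace.basisFun (Fin 3) ℝ).toBasis := by
      refine Module.Basis.eq_of_apply_eq fun i ↦ ?_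
      rw [Module.Basis.map_apply, frameBasis_apply, frame_eq_localFrame hu,
        Trivialization.localFrame_apply_of_mem_baseSet _ _ hb]
      simp [Trivialization.basisAt, Trivialization.apply_mk_symm _ hb]
    rw [he]
  have habs : ∀ u, |volComp o x u| = √(metricMatrix x u).det := fun u ↦ by
    rw [← volComp_sq o, Real.sqrt_sq_eq_abs]
  by_cases h : (EuclideanSpace.basisFun (Fin 3) ℝ).toBasis.orientation = o₀
  · refine ⟨1, key.mono fun u hu ↦ ?_⟩
    rw [one_mul, ← habs, abs_of_pos (hu.2 h)]
  · refine ⟨-1, key.mono fun u hu ↦ ?_⟩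
    rw [← habs, abs_of_nonpos (not_lt.1 fun h' ↦ h (hu.1 h'))]
    ring

lemma contractVolume_frame (hu : u ∈ (extChartAt (𝓡 3) p).target) (P : BivectorField M) :
    contractVolume o P (pt p u) (frame p u 0) = volComp o p u * P.comp p 1 2 u ∧
    contractVolume o P (pt p u) (frame p u 1) = volComp o p u * P.comp p 2 0 u ∧
    contractVolume o P (pt p u) (frame p u 2) = volComp o p u * P.comp p 0 1 u := by
  have hv : ∀ i j k, volumeForm o (pt p u) ![frame p u i, frame p u j, frame p u k] =
      volumeForm o (pt p u) (frame p u ∘ ![i, j, k]) := fun i j k ↦ by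
    congr 1
    ext l
    fin_cases l <;> rfl
  have h0 : ∀ σ : Equiv.Perm (Fin 3), volumeForm o (pt p u) (frame p u ∘ σ) =
      Equiv.Perm.sign σ • volComp o p u := fun σ ↦ AlternatingMap.map_perm _ _ _
  have hz : ∀ i j k : Fin 3, (i = j ∨ i = k ∨ j = k) →
      volumeForm o (pt p u) (frame p u ∘ ![i, j, k]) = 0 := by
    rintro i j k (h | h | h)
    · exact AlternatingMap.map_eq_zero_of_eq _ _ (i := 0) (j := 1) (by simp [h]) (by decide)
    · exact AlternatingMap.map_eq_zero_of_eq _ _ (i := 0) (j := 2) (by simp [h]) (by decide)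
    · exact AlternatingMap.map_eq_zero_of_eq _ _ (i := 1) (j := 2) (by simp [h]) (by decide)
  have h012 : volumeForm o (pt p u) (frame p u ∘ ![0, 1, 2]) = volComp o p u := by
    rw [volComp]; congr 1; ext l; fin_cases l <;> rfl
  have h102 : volumeForm o (pt p u) (frame p u ∘ ![1, 0, 2]) = -volComp o p u := by
    have h := h0 (Equiv.swap 0 1)
    rw [Equiv.Perm.sign_swap (by decide)] at h
    simp only [one_smul, Units.neg_smul] at h
    rw [← h]; congr 1; ext l; fin_cases l <;> rfl
  have h201 : volumeForm o (pt p u) (frame p u ∘ ![2, 0, 1]) = volComp o p u := by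
    have h := h0 (Equiv.swap 0 1 * Equiv.swap 0 2)
    rw [Equiv.Perm.sign_mul, Equiv.Perm.sign_swap (by decide),
      Equiv.Perm.sign_swap (by decide)] at h
    simp only [neg_mul_neg, one_mul, one_smul] at h
    rw [← h]; congr 1; ext l; fin_cases l <;> rfl
  refine ⟨?_, ?_, ?_⟩ <;>
  · simp only [contractVolume]
    rw [functional_eq_comp hu]
    simp only [exteriorPower.alternatingMapLinearEquiv_apply_ιMulti,
      AlternatingMap.curryLeft_apply_apply]
    simp [hv, hz, h012, h102, h201, comp_antisymm hu P 2 0, mul_comm]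

variable [IsContMDiffRiemannianBundle (𝓡 3) ∞ R3 (fun x : M ↦ TangentSpace (𝓡 3) x)]

lemma contDiffAt_volComp (x : M) : ContDiffAt ℝ ∞ (volComp o x) (extChartAt (𝓡 3) x x) := by
  obtain ⟨s, hs⟩ := volComp_eventually_sign o x
  have ht := mem_extChartAt_target (I := 𝓡 3) x
  exact (contDiffAt_const.mul ((contDiffAt_det_metricMatrix ht).sqrt
    (det_metricMatrix_ne_zero ht))).congr_of_eventuallyEq hs

end Volume

section OneForm

variable {M : Type*} [TopologicalSpace M] [ChartedSpace R3 M] [IsManifold (𝓡 3) ∞ M]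

lemma OneForm.isSmooth_of_components (α : OneForm M)
    (h : ∀ (x : M) (i : Fin 3), ContDiffAt ℝ ∞ (fun u ↦ α (pt x u) (frame x u i))
      (extChartAt (𝓡 3) x x)) : α.IsSmooth := by
  intro x
  rw [contMDiffAt_hom_bundle]
  refine ⟨contMDiffAt_id, ?_⟩
  have ht := mem_extChartAt_target (I := 𝓡 3) x
  have h1 : ContDiffAt ℝ ∞ (fun u ↦ ∑ i, α (pt x u) (frame x u i) •
      (EuclideanSpace.proj (𝕜 := ℝ) i : R3 →L[ℝ] ℝ)) (extChartAt (𝓡 3) x x) :=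
    ContDiffAt.sum fun i _ ↦ (h x i).smul contDiffAt_const
  have h2 := h1.contMDiffAt.comp x (contMDiffAt_extChartAt (I := 𝓡 3) (n := ∞) (x := x))
  refine h2.congr_of_eventuallyEq ?_
  filter_upwards [extChartAt_source_mem_nhds (I := 𝓡 3) x] with y hy
  obtain ⟨u, hu, rfl⟩ : ∃ u ∈ (extChartAt (𝓡 3) x).target, pt x u = y :=
    ⟨_, (extChartAt (𝓡 3) x).map_source hy, pt_extChartAt hy⟩
  have hb : pt x u ∈ (trivializationAt R3 (TangentSpace (𝓡 3)) x).baseSet := by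
    rw [TangentBundle.trivializationAt_baseSet]
    exact pt_mem_chart_source hu
  rw [Function.comp_apply, extChartAt_pt hu]
  refine ContinuousLinearMap.coe_injective
    ((EuclideanSpace.basisFun (Fin 3) ℝ).toBasis.ext fun i ↦ ?_)
  simp only [frame_eq_localFrame hu, Trivialization.localFrame_apply_of_mem_baseSet _ _ hb]
  simp [ContinuousLinearMap.inCoordinates, PiLp.single_apply,
    Trivialization.basisAt, Trivialization.symmL_apply _ hb]

variable [RiemannianBundle (fun x : M ↦ TangentSpace (𝓡 3) x)] (o : ManifoldOrientation M)

/-- The one-form `i_π μ`. -/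
noncomputable def contractForm (P : BivectorField M) : OneForm M := fun x ↦
  haveI : FiniteDimensional ℝ (TangentSpace (𝓡 3) x) := inferInstanceAs (FiniteDimensional ℝ R3)
  haveI : T2Space (TangentSpace (𝓡 3) x) := inferInstanceAs (T2Space R3)
  LinearMap.toContinuousLinearMap
    { toFun := contractVolume o P x
      map_add' := fun v w ↦ by simp [contractVolume]
      map_smul' := fun c v ↦ by simp [contractVolume] }

@[simp] lemma contractForm_apply (P : BivectorField M) (x : M) (v : TangentSpace (𝓡 3) x) :
    contractForm o P x v = contractVolume o P x v := rfl

variable [IsContMDiffRiemannianBundle (𝓡 3) ∞ R3 (fun x : M ↦ TangentSpace (𝓡 3) x)]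

lemma contractForm_isSmooth (P : BivectorField M) : (contractForm o P).IsSmooth := by
  refine OneForm.isSmooth_of_components _ fun x i ↦ ?_
  have ht := mem_extChartAt_target (I := 𝓡 3) x
  have hn := target_mem_nhds ht
  have hP := contDiffAt_comp ht P
  have hv := contDiffAt_volComp o x
  fin_cases i
  · exact (hv.mul (hP 1 2)).congr_of_eventuallyEq <|
      Filter.eventually_of_mem hn fun u hu ↦ (contractVolume_frame o hu P).1
  · exact (hv.mul (hP 2 0)).congr_of_eventuallyEq <|
      Filter.eventually_of_mem hn fun u hu ↦ (contractVolume_frame o hu P).2.1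
  · exact (hv.mul (hP 0 1)).congr_of_eventuallyEq <|
      Filter.eventually_of_mem hn fun u hu ↦ (contractVolume_frame o hu P).2.2

end OneForm

section PartialDerivatives

variable {F G : R3 → ℝ} {u : R3}

lemma pderiv_add (i : Fin 3) (hF : DifferentiableAt ℝ F u) (hG : DifferentiableAt ℝ G u) :
    pderiv i (fun w ↦ F w + G w) u = pderiv i F u + pderiv i G u := by
  simp [pderiv, fderiv_fun_add hF hG]

lemma pderiv_sub (i : Fin 3) (hF : DifferentiableAt ℝ F u) (hG : DifferentiableAt ℝ G u) :
    pderiv i (fun w ↦ F w - G w) u = pderiv i F u - pderiv i G u := by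
  simp [pderiv, fderiv_fun_sub hF hG]

lemma pderiv_mul (i : Fin 3) (hF : DifferentiableAt ℝ F u) (hG : DifferentiableAt ℝ G u) :
    pderiv i (fun w ↦ F w * G w) u = pderiv i F u * G u + F u * pderiv i G u := by
  simp [pderiv, fderiv_fun_mul hF hG]
  ring

lemma pderiv_neg (i : Fin 3) : pderiv i (fun w ↦ -F w) u = -pderiv i F u := by
  simp [pderiv]

lemma pderiv_congr (i : Fin 3) (h : F =ᶠ[𝓝 u] G) : pderiv i F u = pderiv i G u := by
  rw [pderiv, pderiv, h.fderiv_eq]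

lemma contDiffAt_pderiv (i : Fin 3) (hF : ContDiffAt ℝ ∞ F u) : ContDiffAt ℝ ∞ (pderiv i F) u :=
  (hF.fderiv_right (m := ∞) (by simp)).clm_apply contDiffAt_const

lemma pderiv_comm (i j : Fin 3) (hF : ContDiffAt ℝ ∞ F u) :
    pderiv i (pderiv j F) u = pderiv j (pderiv i F) u := by
  have hs : IsSymmSndFDerivAt ℝ F u := hF.isSymmSndFDerivAt
    (by simpa using (WithTop.coe_le_coe.2 (le_top : (2 : ℕ∞) ≤ ⊤)))
  have hd : DifferentiableAt ℝ (fderiv ℝ F) u :=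
    (hF.fderiv_right (m := ∞) (by simp)).differentiableAt (by simp)
  have h : ∀ i j, pderiv i (pderiv j F) u = fderiv ℝ (fderiv ℝ F) u (e i) (e j) := fun i j ↦ by
    change fderiv ℝ (fun w ↦ fderiv ℝ F w (e j)) u (e i) = _
    rw [fderiv_clm_apply hd (differentiableAt_const _)]
    simp
  rw [h, h]
  exact hs _ _

lemma bilin_symm_of_basis {L : R3 →L[ℝ] R3 →L[ℝ] ℝ}
    (h : ∀ i j, L (e i) (e j) = L (e j) (e i)) (v w : R3) : L v w = L w v := by
  suffices hL : L = L.flip from congrArg (fun L : R3 →L[ℝ] R3 →L[ℝ] ℝ ↦ L v w) hL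
  refine ContinuousLinearMap.coe_injective
    ((EuclideanSpace.basisFun (Fin 3) ℝ).toBasis.ext fun i ↦ ?_)
  refine ContinuousLinearMap.coe_injective
    ((EuclideanSpace.basisFun (Fin 3) ℝ).toBasis.ext fun j ↦ ?_)
  simpa [e] using h i j

end PartialDerivatives

section Christoffel

variable {M : Type*} [TopologicalSpace M] [ChartedSpace R3 M]
  [RiemannianBundle (fun x : M ↦ TangentSpace (𝓡 3) x)] {p : M} {u : R3}

lemma pderiv_metricMatrix_comm (k i j : Fin 3) :
    pderiv k (fun w ↦ metricMatrix p w i j) u = pderiv k (fun w ↦ metricMatrix p w j i) u := by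
  simp only [metricMatrix_comm p _ i j]

lemma christoffel_comm (k i j : Fin 3) : christoffel p u k i j = christoffel p u k j i := by
  simp only [christoffel, pderiv_metricMatrix_comm _ i j]
  congr 1
  exact Finset.sum_congr rfl fun l _ ↦ by ring

variable [IsManifold (𝓡 3) ∞ M] (o : ManifoldOrientation M)
  [IsContMDiffRiemannianBundle (𝓡 3) ∞ R3 (fun x : M ↦ TangentSpace (𝓡 3) x)]

/-- Jacobi's formula for the determinant of the metric. -/
lemma pderiv_det_metricMatrix (hu : u ∈ (extChartAt (𝓡 3) p).target) (k : Fin 3) :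
    pderiv k (fun w ↦ (metricMatrix p w).det) u =
      (metricMatrix p u).det * ∑ i, ∑ l, (metricMatrix p u)⁻¹ i l *
        pderiv k (fun w ↦ metricMatrix p w i l) u := by
  have hd : ∀ i j, DifferentiableAt ℝ (fun w ↦ metricMatrix p w i j) u := fun i j ↦
    (contDiffAt_metricMatrix hu i j).differentiableAt (by simp)
  have hadj : ∀ i l, (metricMatrix p u).det * (metricMatrix p u)⁻¹ i l =
      (metricMatrix p u).adjugate i l := fun i l ↦ by
    rw [Matrix.inv_def]
    simp [det_metricMatrix_ne_zero hu]
  simp only [Finset.mul_sum, ← mul_assoc, hadj]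
  simp only [Matrix.det_fin_three]
  simp (disch := fun_prop) only [pderiv_add, pderiv_sub, pderiv_mul]
  simp only [Matrix.adjugate_fin_three, Fin.sum_univ_three, pderiv_metricMatrix_comm _ 1 0,
    pderiv_metricMatrix_comm _ 2 0, pderiv_metricMatrix_comm _ 2 1,
    metricMatrix_comm p u 1 0, metricMatrix_comm p u 2 0, metricMatrix_comm p u 2 1]
  simp
  ring

lemma sum_christoffel (hu : u ∈ (extChartAt (𝓡 3) p).target)
    (hm : DifferentiableAt ℝ (volComp o p) u) (k : Fin 3) :
    ∑ i, christoffel p u i i k = pderiv k (volComp o p) u / volComp o p u := by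
  have h1 := pderiv_det_metricMatrix hu k
  rw [← volComp_sq o p u, show (fun w ↦ (metricMatrix p w).det) =
    fun w ↦ volComp o p w * volComp o p w from funext fun w ↦ by rw [← volComp_sq o p w, sq],
    pderiv_mul k hm hm] at h1
  have hne := volComp_ne_zero o hu
  have h2 : 2 * ∑ i, christoffel p u i i k = ∑ i, ∑ l, (metricMatrix p u)⁻¹ i l *
        pderiv k (fun w ↦ metricMatrix p w i l) u := by
    simp only [christoffel, ← cometric_eq_inv hu, Fin.sum_univ_three]
    rw [cometric_comm p 1 0, cometric_comm p 2 0, cometric_comm p 2 1]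
    simp only [pderiv_metricMatrix_comm _ 1 0,
      pderiv_metricMatrix_comm _ 2 0, pderiv_metricMatrix_comm _ 2 1]
    fin_cases k <;> simp only [
      Fin.zero_eta, Fin.mk_one, Fin.reduceFinMk, pderiv_metricMatrix_comm _ 1 0,
      pderiv_metricMatrix_comm _ 2 0, pderiv_metricMatrix_comm _ 2 1] <;> ring
  rw [← h2] at h1
  rw [eq_div_iff hne]
  have h3 : volComp o p u * (2 * ((∑ i, christoffel p u i i k) * volComp o p u -
      pderiv k (volComp o p) u)) = 0 := by linear_combination -h1
  have h4 := (mul_eq_zero.1 h3).resolve_left hne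
  linarith

end Christoffel

section Divergence

variable {M : Type*} [TopologicalSpace M] [ChartedSpace R3 M] [IsManifold (𝓡 3) ∞ M]
  [RiemannianBundle (fun x : M ↦ TangentSpace (𝓡 3) x)] (o : ManifoldOrientation M)
  [IsContMDiffRiemannianBundle (𝓡 3) ∞ R3 (fun x : M ↦ TangentSpace (𝓡 3) x)]

lemma divVec_eq (X : VectorField M) (x : M) :
    divVec X x = ∑ i, pderiv i (vecComp X x i) (extChartAt (𝓡 3) x x) +
      ∑ k, pderiv k (volComp o x) (extChartAt (𝓡 3) x x) / volComp o x (extChartAt (𝓡 3) x x) *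
        vecComp X x k (extChartAt (𝓡 3) x x) := by
  have hm := (contDiffAt_volComp o x).differentiableAt (by simp)
  simp only [divVec, covDerivVec, Finset.sum_add_distrib]
  rw [Finset.sum_comm]
  simp only [← Finset.sum_mul, sum_christoffel o (mem_extChartAt_target x) hm]

lemma volComp_mul_divBivec (P : BivectorField M) (x : M) (j : Fin 3) :
    volComp o x (extChartAt (𝓡 3) x x) * divBivec P x j =
      ∑ i, pderiv i (fun u ↦ volComp o x u * P.comp x i j u) (extChartAt (𝓡 3) x x) := by
  have ht := mem_extChartAt_target (I := 𝓡 3) x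
  have hm := (contDiffAt_volComp o x).differentiableAt (by simp)
  have hP := fun i ↦ (contDiffAt_comp ht P i j).differentiableAt (by simp)
  simp only [divBivec, covDerivBivec, Finset.sum_add_distrib]
  rw [Finset.sum_comm]
  simp only [← Finset.sum_mul, sum_christoffel o ht hm]
  have h0 : ∑ i, ∑ k, christoffel x (extChartAt (𝓡 3) x x) j i k *
      P.comp x i k (extChartAt (𝓡 3) x x) = 0 := by
    simp only [Fin.sum_univ_three, comp_self ht, comp_antisymm ht P 1 0, comp_antisymm ht P 2 0,
      comp_antisymm ht P 2 1, christoffel_comm j 1 0, christoffel_comm j 2 0,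
      christoffel_comm j 2 1]
    ring
  have hne := volComp_ne_zero o ht
  rw [h0, add_zero, mul_add, Finset.mul_sum, Finset.mul_sum, ← Finset.sum_add_distrib]
  refine Finset.sum_congr rfl fun i _ ↦ ?_
  rw [pderiv_mul i hm (hP i)]
  field_simp
  ring

/-- `i_π μ` is closed if and only if `π` is divergence free. -/
lemma contractForm_isClosed_iff (P : BivectorField M) :
    (contractForm o P).IsClosed ↔ ∀ x j, divBivec P x j = 0 := by
  refine forall_congr' fun x ↦ ?_
  set u₀ := extChartAt (𝓡 3) x x with hu₀
  have ht : u₀ ∈ (extChartAt (𝓡 3) x).target := mem_extChartAt_target (I := 𝓡 3) x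
  have hm := (contDiffAt_volComp o x).differentiableAt (by simp)
  have hP := fun i j ↦ (contDiffAt_comp ht P i j).differentiableAt (by simp)
  have hd : ∀ i j, DifferentiableAt ℝ (fun u ↦ volComp o x u * P.comp x i j u) u₀ :=
    fun i j ↦ hm.mul (hP i j)
  set q : Fin 3 → R3 → ℝ := ![fun u ↦ volComp o x u * P.comp x 1 2 u,
    fun u ↦ volComp o x u * P.comp x 2 0 u, fun u ↦ volComp o x u * P.comp x 0 1 u] with hq
  have hqd : ∀ i, DifferentiableAt ℝ (q i) u₀ := by
    intro i
    fin_cases i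
    exacts [hd 1 2, hd 2 0, hd 0 1]
  have he : (contractForm o P).inChart x =ᶠ[𝓝 u₀]
      fun u ↦ ∑ i, q i u • (EuclideanSpace.proj (𝕜 := ℝ) i : R3 →L[ℝ] ℝ) := by
    filter_upwards [target_mem_nhds ht] with u hu
    refine ContinuousLinearMap.coe_injective
      ((EuclideanSpace.basisFun (Fin 3) ℝ).toBasis.ext fun i ↦ ?_)
    obtain ⟨h0, h1, h2⟩ := contractVolume_frame o hu P
    simp only [OneForm.inChart]
    have : contractVolume o P (pt x u) (frame x u i) = q i u := by
      fin_cases i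
      exacts [h0, h1, h2]
    simpa [PiLp.single_apply, frame, e] using this
  have hL : ∀ i j, fderiv ℝ ((contractForm o P).inChart x) u₀ (e i) (e j) = pderiv i (q j) u₀ := by
    intro i j
    rw [he.fderiv_eq, fderiv_fun_sum
      (A := fun k u ↦ q k u • (EuclideanSpace.proj (𝕜 := ℝ) k : R3 →L[ℝ] ℝ))
      fun k _ ↦ (hqd k).smul_const _]
    have hk : ∀ k, fderiv ℝ (fun u ↦ q k u • (EuclideanSpace.proj (𝕜 := ℝ) k : R3 →L[ℝ] ℝ)) u₀ =
        (fderiv ℝ (q k) u₀).smulRight (EuclideanSpace.proj (𝕜 := ℝ) k : R3 →L[ℝ] ℝ) :=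
      fun k ↦ ((hqd k).hasFDerivAt.smul_const
        (EuclideanSpace.proj (𝕜 := ℝ) k : R3 →L[ℝ] ℝ)).fderiv
    simp [hk, pderiv, e, PiLp.single_apply]
  have hdiv : ∀ j, volComp o x u₀ * divBivec P x j = _ := volComp_mul_divBivec o P x
  have hzero : ∀ i j, pderiv i (fun u ↦ volComp o x u * P.comp x j j u) u₀ = 0 := fun i j ↦ by
    rw [pderiv_congr i (G := fun _ ↦ 0)]
    · simp [pderiv]
    · filter_upwards [target_mem_nhds ht] with u hu
      rw [comp_self hu, mul_zero]
  have hneg : ∀ i j k, pderiv i (fun u ↦ volComp o x u * P.comp x j k u) u₀ =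
      -pderiv i (fun u ↦ volComp o x u * P.comp x k j u) u₀ := fun i j k ↦ by
    rw [← pderiv_neg, pderiv_congr i]
    filter_upwards [target_mem_nhds ht] with u hu
    rw [comp_antisymm hu, mul_neg]
  have hne := volComp_ne_zero o ht
  have h0 : volComp o x u₀ * divBivec P x 0 = pderiv 2 (q 1) u₀ - pderiv 1 (q 2) u₀ := by
    rw [hdiv, Fin.sum_univ_three, ← hu₀, hzero, hneg 1 1 0]
    simp [hq]; ring
  have h1 : volComp o x u₀ * divBivec P x 1 = pderiv 0 (q 2) u₀ - pderiv 2 (q 0) u₀ := by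
    rw [hdiv, Fin.sum_univ_three, ← hu₀, hzero, hneg 2 2 1]
    simp [hq]; ring
  have h2 : volComp o x u₀ * divBivec P x 2 = pderiv 1 (q 0) u₀ - pderiv 0 (q 1) u₀ := by
    rw [hdiv, Fin.sum_univ_three, ← hu₀, hzero, hneg 0 0 2]
    simp [hq]; ring
  constructor
  · intro h j
    have hs : ∀ i j, pderiv i (q j) u₀ - pderiv j (q i) u₀ = 0 := fun i j ↦ by
      rw [← hL, ← hL]
      exact h (e i) (e j)
    refine (mul_eq_zero.1 ?_).resolve_left hne
    fin_cases j
    exacts [h0.trans (hs _ _), h1.trans (hs _ _), h2.trans (hs _ _)]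
  · intro h v w
    rw [h, mul_zero] at h0 h1 h2
    change fderiv ℝ ((contractForm o P).inChart x) u₀ v w
      - fderiv ℝ ((contractForm o P).inChart x) u₀ w v = 0
    refine sub_eq_zero.2 (bilin_symm_of_basis (fun i j ↦ ?_) v w)
    rw [hL, hL]
    fin_cases i <;> fin_cases j <;> simp <;> linarith

end Divergence

section Triple

/-- The scalar triple product of three covectors of `ℝ³`. -/
def triple (α β γ : Fin 3 → ℝ) : ℝ :=
  α 0 * (β 1 * γ 2 - β 2 * γ 1) + α 1 * (β 2 * γ 0 - β 0 * γ 2) + α 2 * (β 0 * γ 1 - β 1 * γ 0)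

/-- The coordinate gradient of a function on `ℝ³`. -/
noncomputable def pgrad (F : R3 → ℝ) (u : R3) (i : Fin 3) : ℝ := pderiv i F u

/-- The derivative of the coordinate gradient in the `i`-th direction. -/
noncomputable def phess (F : R3 → ℝ) (u : R3) (i j : Fin 3) : ℝ := pderiv i (pderiv j F) u

variable {F A B ρ : R3 → ℝ} {u : R3}

lemma phess_comm (hF : ContDiffAt ℝ ∞ F u) (i j : Fin 3) : phess F u i j = phess F u j i :=
  pderiv_comm i j hF

lemma pderiv_mul_triple (hρ : DifferentiableAt ℝ ρ u) (hF : ContDiffAt ℝ ∞ F u)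
    (hA : ContDiffAt ℝ ∞ A u) (hB : ContDiffAt ℝ ∞ B u) (i : Fin 3) :
    pderiv i (fun w ↦ ρ w * triple (pgrad F w) (pgrad A w) (pgrad B w)) u =
      pderiv i ρ u * triple (pgrad F u) (pgrad A u) (pgrad B u) +
        ρ u * (triple (phess F u i) (pgrad A u) (pgrad B u) +
          triple (pgrad F u) (phess A u i) (pgrad B u) +
          triple (pgrad F u) (pgrad A u) (phess B u i)) := by
  have h : ∀ {G : R3 → ℝ}, ContDiffAt ℝ ∞ G u → ∀ j, DifferentiableAt ℝ (pderiv j G) u :=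
    fun hG j ↦ (contDiffAt_pderiv j hG).differentiableAt (by simp)
  have hF' := h hF
  have hA' := h hA
  have hB' := h hB
  simp only [triple, pgrad, phess]
  simp (disch := fun_prop) only [pderiv_add, pderiv_sub, pderiv_mul]
  ring

/-- The Jacobi identity for the bracket `ρ ∇F · (∇A × ∇B)`, in terms of derivatives at a point. -/
lemma triple_jacobi (r : ℝ) (dr f a b c : Fin 3 → ℝ) (Hf Ha Hb Hc : Fin 3 → Fin 3 → ℝ)
    (hf : ∀ i j, Hf i j = Hf j i) (ha : ∀ i j, Ha i j = Ha j i) (hb : ∀ i j, Hb i j = Hb j i)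
    (hc : ∀ i j, Hc i j = Hc j i) :
    r * triple f a (fun i ↦ dr i * triple f b c +
        r * (triple (Hf i) b c + triple f (Hb i) c + triple f b (Hc i))) +
      r * triple f b (fun i ↦ dr i * triple f c a +
        r * (triple (Hf i) c a + triple f (Hc i) a + triple f c (Ha i))) +
      r * triple f c (fun i ↦ dr i * triple f a b +
        r * (triple (Hf i) a b + triple f (Ha i) b + triple f a (Hb i))) = 0 := by
  simp only [triple, hf 1 0, hf 2 0, hf 2 1, ha 1 0, ha 2 0, ha 2 1, hb 1 0, hb 2 0, hb 2 1,
    hc 1 0, hc 2 0, hc 2 1]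
  ring

/-- The Lie derivative of the bracket `ρ ∇F · (∇A × ∇B)` along a vector field with components `X`
and derivatives `DX i k = ∂_i X^k`, in terms of derivatives at a point. -/
lemma triple_lie (r : ℝ) (dr f a b X : Fin 3 → ℝ) (DX Hf Ha Hb : Fin 3 → Fin 3 → ℝ)
    (hf : ∀ i j, Hf i j = Hf j i) (ha : ∀ i j, Ha i j = Ha j i) (hb : ∀ i j, Hb i j = Hb j i) :
    ∑ i, X i * (dr i * triple f a b +
        r * (triple (Hf i) a b + triple f (Ha i) b + triple f a (Hb i))) -
      r * triple f (fun i ↦ ∑ k, (DX i k * a k + X k * Ha i k)) b -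
      r * triple f a (fun i ↦ ∑ k, (DX i k * b k + X k * Hb i k)) =
    r * triple (fun i ↦ ∑ k, (DX i k * f k + X k * Hf i k)) a b -
      (r * ∑ i, DX i i - ∑ k, dr k * X k) * triple f a b := by
  simp only [triple, Fin.sum_univ_three, hf 1 0, hf 2 0, hf 2 1, ha 1 0, ha 2 0, ha 2 1, hb 1 0,
    hb 2 0, hb 2 1]
  ring

end Triple

section Bracket

variable {M : Type*} [TopologicalSpace M] [ChartedSpace R3 M]

lemma SmoothOn.mdifferentiableAt {a : M → ℝ} {U : Set M} (ha : SmoothOn a U) (hU : IsOpen U)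
    {y : M} (hy : y ∈ U) : MDifferentiableAt (𝓡 3) 𝓘(ℝ, ℝ) a y :=
  (ha.contMDiffAt (hU.mem_nhds hy)).mdifferentiableAt (by simp)

lemma SmoothOn.bracket {P : BivectorField M} {a b : M → ℝ} {U : Set M} (hU : IsOpen U)
    (ha : SmoothOn a U) (hb : SmoothOn b U) : SmoothOn (P.bracket a b) U :=
  P.smooth U hU a b ha hb

lemma eventually_pt_mem {x : M} {U : Set M} (hU : IsOpen U) (hx : x ∈ U) :
    ∀ᶠ u in 𝓝 (extChartAt (𝓡 3) x x), u ∈ (extChartAt (𝓡 3) x).target ∧ pt x u ∈ U := by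
  have ht := mem_extChartAt_target (I := 𝓡 3) x
  refine (Filter.eventually_of_mem (target_mem_nhds ht) fun _ h ↦ h).and
    ((continuousAt_pt ht).eventually (hU.mem_nhds ?_))
  rwa [pt_self]

variable [IsManifold (𝓡 3) ∞ M]

lemma act_pt {p : M} {u : R3} (hu : u ∈ (extChartAt (𝓡 3) p).target) (X : VectorField M)
    {a : M → ℝ} (ha : MDifferentiableAt (𝓡 3) 𝓘(ℝ, ℝ) a (pt p u)) :
    act X a (pt p u) = ∑ i, vecComp X p i u * pderiv i (a ∘ pt p) u := by
  rw [act, ← sum_coframe_smul_frame hu (X (pt p u)), map_sum]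
  refine Finset.sum_congr rfl fun i _ ↦ ?_
  rw [map_smul, d_frame hu ha, smul_eq_mul, vecComp]

lemma SmoothOn.contDiffAt {a : M → ℝ} {U : Set M} (ha : SmoothOn a U) (hU : IsOpen U)
    {x : M} (hx : x ∈ U) : ContDiffAt ℝ ∞ (a ∘ pt x) (extChartAt (𝓡 3) x x) := by
  refine contDiffAt_comp_pt (mem_extChartAt_target x) (ha.contMDiffAt ?_)
  rw [pt_self]
  exact hU.mem_nhds hx

variable [RiemannianBundle (fun x : M ↦ TangentSpace (𝓡 3) x)] {o : ManifoldOrientation M}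
  {P : BivectorField M} {f : M → ℝ}

section

variable {p : M} {u : R3} (hu : u ∈ (extChartAt (𝓡 3) p).target) (hf : Smooth f)
  (hPf : ∀ x v, contractVolume o P x v = d f x v)
include hu hf hPf

lemma eval_eq_triple (α β : TangentSpace (𝓡 3) (pt p u) →L[ℝ] ℝ) :
    P.eval (pt p u) α β = (volComp o p u)⁻¹ * triple (pgrad (f ∘ pt p) u)
      (fun i ↦ α (frame p u i)) (fun i ↦ β (frame p u i)) := by
  obtain ⟨h0, h1, h2⟩ := contractVolume_frame o hu P
  have hm := volComp_ne_zero o hu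
  have hfd : MDifferentiableAt (𝓡 3) 𝓘(ℝ, ℝ) f (pt p u) :=
    (hf _).mdifferentiableAt (by simp)
  rw [hPf, d_frame hu hfd] at h0 h1 h2
  rw [eval_eq_comp hu, comp_antisymm hu P 0 2]
  simp only [triple, pgrad, h0, h1, h2]
  field_simp
  ring

lemma bracket_pt {a b : M → ℝ} (ha : MDifferentiableAt (𝓡 3) 𝓘(ℝ, ℝ) a (pt p u))
    (hb : MDifferentiableAt (𝓡 3) 𝓘(ℝ, ℝ) b (pt p u)) :
    P.bracket a b (pt p u) = (volComp o p u)⁻¹ *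
      triple (pgrad (f ∘ pt p) u) (pgrad (a ∘ pt p) u) (pgrad (b ∘ pt p) u) := by
  rw [BivectorField.bracket, eval_eq_triple hu hf hPf]
  simp only [d_frame hu ha, d_frame hu hb]
  rfl

end

variable (hf : Smooth f) (hPf : ∀ x v, contractVolume o P x v = d f x v)
  [IsContMDiffRiemannianBundle (𝓡 3) ∞ R3 (fun x : M ↦ TangentSpace (𝓡 3) x)]
include hf hPf

lemma pderiv_bracket {a b : M → ℝ} {U : Set M} (hU : IsOpen U) (ha : SmoothOn a U)
    (hb : SmoothOn b U) {x : M} (hx : x ∈ U) (i : Fin 3) :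
    pderiv i (P.bracket a b ∘ pt x) (extChartAt (𝓡 3) x x) =
      pderiv i (fun w ↦ (volComp o x w)⁻¹) (extChartAt (𝓡 3) x x) *
        triple (pgrad (f ∘ pt x) (extChartAt (𝓡 3) x x))
          (pgrad (a ∘ pt x) (extChartAt (𝓡 3) x x)) (pgrad (b ∘ pt x) (extChartAt (𝓡 3) x x)) +
      (volComp o x (extChartAt (𝓡 3) x x))⁻¹ *
        (triple (phess (f ∘ pt x) (extChartAt (𝓡 3) x x) i)
          (pgrad (a ∘ pt x) (extChartAt (𝓡 3) x x)) (pgrad (b ∘ pt x) (extChartAt (𝓡 3) x x)) +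
        triple (pgrad (f ∘ pt x) (extChartAt (𝓡 3) x x))
          (phess (a ∘ pt x) (extChartAt (𝓡 3) x x) i) (pgrad (b ∘ pt x) (extChartAt (𝓡 3) x x)) +
        triple (pgrad (f ∘ pt x) (extChartAt (𝓡 3) x x))
          (pgrad (a ∘ pt x) (extChartAt (𝓡 3) x x))
          (phess (b ∘ pt x) (extChartAt (𝓡 3) x x) i)) := by
  have ht := mem_extChartAt_target (I := 𝓡 3) x
  have hρ : DifferentiableAt ℝ (fun w ↦ (volComp o x w)⁻¹) (extChartAt (𝓡 3) x x) :=
    ((contDiffAt_volComp o x).differentiableAt (by simp)).inv (volComp_ne_zero o ht)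
  rw [← pderiv_mul_triple hρ (contDiffAt_comp_pt ht (hf _)) (ha.contDiffAt hU hx)
    (hb.contDiffAt hU hx)]
  refine pderiv_congr i ?_
  filter_upwards [eventually_pt_mem hU hx] with u hu
  exact bracket_pt hu.1 hf hPf (ha.mdifferentiableAt hU hu.2) (hb.mdifferentiableAt hU hu.2)

lemma isPoisson_of_contractVolume_eq : P.IsPoisson := by
  intro a b c ha hb hc x
  have ht := mem_extChartAt_target (I := 𝓡 3) x
  have hu := isOpen_univ (X := M)
  have ha' : SmoothOn a univ := ha.contMDiffOn
  have hb' : SmoothOn b univ := hb.contMDiffOn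
  have hc' : SmoothOn c univ := hc.contMDiffOn
  have key : ∀ a b c, SmoothOn a univ → SmoothOn b univ → SmoothOn c univ → _ :=
    fun a b c (ha : SmoothOn a univ) (hb : SmoothOn b univ) (hc : SmoothOn c univ) ↦
      bracket_pt ht hf hPf (ha.mdifferentiableAt hu (mem_univ _))
        ((SmoothOn.bracket (P := P) hu hb hc).mdifferentiableAt hu (mem_univ _))
  simp only [pt_self] at key
  rw [key a b c ha' hb' hc', key b c a hb' hc' ha', key c a b hc' ha' hb']
  have hg : ∀ b c, SmoothOn b univ → SmoothOn c univ →
      pgrad (P.bracket b c ∘ pt x) (extChartAt (𝓡 3) x x) = _ :=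
    fun b c hb hc ↦ funext fun i ↦ pderiv_bracket hf hPf hu hb hc (mem_univ x) i
  rw [hg b c hb' hc', hg c a hc' ha', hg a b ha' hb']
  exact triple_jacobi _ _ _ _ _ _ _ _ _ _ (phess_comm (contDiffAt_comp_pt ht (hf _)))
    (phess_comm (contDiffAt_comp_pt ht (ha _))) (phess_comm (contDiffAt_comp_pt ht (hb _)))
    (phess_comm (contDiffAt_comp_pt ht (hc _)))

lemma lieDeriv_eq_triple {a b : M → ℝ} {U : Set M} (hU : IsOpen U) (ha : SmoothOn a U)
    (hb : SmoothOn b U) {x : M} (hx : x ∈ U) {X : VectorField M}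
    (hX : ∀ i, ContDiffAt ℝ ∞ (vecComp X x i) (extChartAt (𝓡 3) x x)) :
    P.lieDeriv X a b x = (volComp o x (extChartAt (𝓡 3) x x))⁻¹ *
      triple (fun i ↦ pderiv i (fun w ↦ ∑ k, vecComp X x k w * pderiv k (f ∘ pt x) w)
          (extChartAt (𝓡 3) x x) - divVec X x * pderiv i (f ∘ pt x) (extChartAt (𝓡 3) x x))
        (pgrad (a ∘ pt x) (extChartAt (𝓡 3) x x)) (pgrad (b ∘ pt x) (extChartAt (𝓡 3) x x)) := by
  set u₀ := extChartAt (𝓡 3) x x with hu₀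
  have ht : u₀ ∈ (extChartAt (𝓡 3) x).target := mem_extChartAt_target (I := 𝓡 3) x
  have hm := volComp_ne_zero o ht
  have hmd := (contDiffAt_volComp o x).differentiableAt (by simp)
  have hxU : pt x u₀ ∈ U := by rwa [hu₀, pt_self]
  have hXd : ∀ k, DifferentiableAt ℝ (vecComp X x k) u₀ := fun k ↦ (hX k).differentiableAt (by simp)
  have hact : ∀ {a : M → ℝ}, SmoothOn a U → act X a ∘ pt x =ᶠ[𝓝 u₀]
      fun w ↦ ∑ k, vecComp X x k w * pderiv k (a ∘ pt x) w := fun {a} ha ↦ by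
    filter_upwards [eventually_pt_mem hU hx] with u hu
    exact act_pt hu.1 X (ha.mdifferentiableAt hU hu.2)
  have hsmooth : ∀ {A : R3 → ℝ}, ContDiffAt ℝ ∞ A u₀ →
      ContDiffAt ℝ ∞ (fun w ↦ ∑ k, vecComp X x k w * pderiv k A w) u₀ := fun hA ↦
    ContDiffAt.sum fun k _ ↦ (hX k).mul (contDiffAt_pderiv k hA)
  have hpd : ∀ {A : R3 → ℝ}, ContDiffAt ℝ ∞ A u₀ → ∀ i,
      pderiv i (fun w ↦ ∑ k, vecComp X x k w * pderiv k A w) u₀ =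
        ∑ k, (pderiv i (vecComp X x k) u₀ * pgrad A u₀ k + vecComp X x k u₀ * phess A u₀ i k) :=
      fun {A} hA i ↦ by
    have hA' : ∀ j, DifferentiableAt ℝ (pderiv j A) u₀ :=
      fun j ↦ (contDiffAt_pderiv j hA).differentiableAt (by simp)
    simp only [Fin.sum_univ_three]
    simp (disch := fun_prop) only [pderiv_add, pderiv_mul]
    rfl
  have hactd : ∀ {a : M → ℝ}, SmoothOn a U →
      MDifferentiableAt (𝓡 3) 𝓘(ℝ, ℝ) (act X a) (pt x u₀) := fun ha ↦
    (contMDiffAt_of_comp_pt ht ((hsmooth (ha.contDiffAt hU hx)).congr_of_eventuallyEq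
      (hact ha))).mdifferentiableAt (by simp)
  have hgact : ∀ {a : M → ℝ}, SmoothOn a U → pgrad (act X a ∘ pt x) u₀ =
      fun i ↦ ∑ k, (pderiv i (vecComp X x k) u₀ * pgrad (a ∘ pt x) u₀ k +
        vecComp X x k u₀ * phess (a ∘ pt x) u₀ i k) := fun ha ↦ funext fun i ↦ by
    rw [pgrad, pderiv_congr i (hact ha), hpd (ha.contDiffAt hU hx)]
  have h1 := act_pt ht X ((SmoothOn.bracket (P := P) hU ha hb).mdifferentiableAt hU hxU)
  have h2 := bracket_pt ht hf hPf (hactd ha) (hb.mdifferentiableAt hU hxU)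
  have h3 := bracket_pt ht hf hPf (ha.mdifferentiableAt hU hxU) (hactd hb)
  rw [hu₀, pt_self, ← hu₀] at h1 h2 h3
  rw [hgact ha] at h2
  rw [hgact hb] at h3
  simp only [hu₀, pderiv_bracket hf hPf hU ha hb hx] at h1
  have hl := triple_lie (volComp o x u₀)⁻¹ (fun i ↦ pderiv i (fun w ↦ (volComp o x w)⁻¹) u₀)
    (pgrad (f ∘ pt x) u₀) (pgrad (a ∘ pt x) u₀) (pgrad (b ∘ pt x) u₀)
    (fun k ↦ vecComp X x k u₀) (fun i k ↦ pderiv i (vecComp X x k) u₀) _ _ _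
    (phess_comm (contDiffAt_comp_pt ht (hf _))) (phess_comm (ha.contDiffAt hU hx))
    (phess_comm (hb.contDiffAt hU hx))
  have hlie : P.lieDeriv X a b x = act X (P.bracket a b) x - P.bracket (act X a) b x -
    P.bracket a (act X b) x := rfl
  have hinv : ∀ k, pderiv k (fun w ↦ (volComp o x w)⁻¹) u₀ =
      -(volComp o x u₀)⁻¹ * (pderiv k (volComp o x) u₀ / volComp o x u₀) := fun k ↦ by
    have hinvd : DifferentiableAt ℝ (fun w ↦ (volComp o x w)⁻¹) u₀ := hmd.inv hm
    have h := pderiv_mul k hmd hinvd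
    rw [pderiv_congr k (G := fun _ ↦ 1),
      show pderiv k (fun _ ↦ (1 : ℝ)) u₀ = 0 by simp [pderiv]] at h
    · generalize pderiv k (fun w ↦ (volComp o x w)⁻¹) u₀ = z at h ⊢
      rw [← hu₀] at h
      field_simp at h ⊢
      linear_combination -h
    · filter_upwards [target_mem_nhds ht] with w hw
      exact mul_inv_cancel₀ (volComp_ne_zero o hw)
  rw [hlie, h1, h2, h3, ← hu₀]
  refine hl.trans ?_
  simp only [hpd (contDiffAt_comp_pt ht (hf _)), divVec_eq o, ← hu₀, hinv]
  simp only [triple, pgrad, Fin.sum_univ_three]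
  ring

end Bracket

section Algebra

/-- The covector `d⟨dg, df⟩ - div(∇g) df` in terms of derivatives at a point: `h`, `dh` are the
inverse metric and its derivatives, `t` is the logarithmic derivative of the volume, `f`, `g` and
`Hf`, `Hg` are the first and second derivatives of the functions. -/
def obstruction (h : Fin 3 → Fin 3 → ℝ) (dh : Fin 3 → Fin 3 → Fin 3 → ℝ) (t g f : Fin 3 → ℝ)
    (Hg Hf : Fin 3 → Fin 3 → ℝ) (k : Fin 3) : ℝ :=
  ∑ i, ∑ j, (dh k i j * g j * f i + h i j * Hg k j * f i + h i j * g j * Hf k i) -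
    (∑ i, ∑ j, (dh i i j * g j + h i j * Hg i j) + ∑ i, ∑ j, t i * (h i j * g j)) * f k

lemma obstruction_eq_zero_of_parallel {h : Fin 3 → Fin 3 → ℝ} {dh : Fin 3 → Fin 3 → Fin 3 → ℝ}
    {t g f : Fin 3 → ℝ} {Hg Hf : Fin 3 → Fin 3 → ℝ}
    (hHg : ∀ i j, Hg i j = Hg j i) (hHf : ∀ i j, Hf i j = Hf j i)
    (hfg : ∀ i j, f i * g j = f j * g i)
    (hdfg : ∀ l i j, Hf l i * g j + f i * Hg l j = Hf l j * g i + f j * Hg l i)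
    {m : Fin 3} (hm : f m ≠ 0) (hobs : ∀ k, obstruction h dh t f f Hf Hf k = 0) (k : Fin 3) :
    obstruction h dh t g f Hg Hf k = 0 := by
  obtain ⟨r, hr⟩ : ∃ r, ∀ j, g j = r * f j :=
    ⟨g m / f m, fun j ↦ by field_simp; linear_combination hfg m j⟩
  have hK : ∀ l i j, f i * (Hg l j - r * Hf l j) = f j * (Hg l i - r * Hf l i) := fun l i j ↦ by
    have := hdfg l i j
    rw [hr, hr] at this
    linear_combination this
  obtain ⟨c, hc⟩ : ∃ c, ∀ l j, Hg l j = r * Hf l j + c * f l * f j := by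
    refine ⟨(Hg m m - r * Hf m m) / f m ^ 2, fun l j ↦ ?_⟩
    have h1 := hK l m j
    have h2 := hK m m l
    rw [hHg m l, hHf m l] at h2
    field_simp
    linear_combination f m * h1 + f j * h2
  have h0 := hobs k
  simp only [obstruction, Fin.sum_univ_three, hr, hc] at h0 ⊢
  linear_combination r * h0

lemma eq_zero_of_triple_single {α : Fin 3 → ℝ}
    (h : ∀ i j, triple α (Pi.single i 1) (Pi.single j 1) = 0) : α = 0 := by
  have h0 := h 1 2
  have h1 := h 2 0
  have h2 := h 0 1
  simp [triple] at h0 h1 h2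
  ext i
  fin_cases i
  exacts [h0, h1, h2]

end Algebra

section Gradient

variable {M : Type*} [TopologicalSpace M] [ChartedSpace R3 M] [IsManifold (𝓡 3) ∞ M]

lemma pgrad_coord {p : M} {u : R3} (hu : u ∈ (extChartAt (𝓡 3) p).target) (i : Fin 3) :
    pgrad (coord p i ∘ pt p) u = Pi.single i 1 := by
  ext j
  rw [pgrad, ← d_frame hu ((smoothOn_coord p i).mdifferentiableAt
    (isOpen_extChartAt_source p) (pt_mem_source hu))]
  refine (coframe_frame hu i j).trans ?_
  simp [Pi.single_apply, eq_comm]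

variable [RiemannianBundle (fun x : M ↦ TangentSpace (𝓡 3) x)]

lemma vecComp_grad {p : M} {u : R3} (hu : u ∈ (extChartAt (𝓡 3) p).target) {g : M → ℝ}
    (hg : MDifferentiableAt (𝓡 3) 𝓘(ℝ, ℝ) g (pt p u)) (i : Fin 3) :
    vecComp (grad g) p i u = ∑ j, cometric p i j u * pderiv j (g ∘ pt p) u := by
  rw [vecComp, grad, coframe_sharp hu]
  simp only [d_frame hu hg]

variable {U : Set M} (hU : IsOpen U) {g : M → ℝ} (hg : SmoothOn g U) {x : M}
include hU hg

lemma vecComp_grad_eventuallyEq (hx : x ∈ U) (i : Fin 3) :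
    vecComp (grad g) x i =ᶠ[𝓝 (extChartAt (𝓡 3) x x)]
      fun u ↦ ∑ j, cometric x i j u * pderiv j (g ∘ pt x) u := by
  filter_upwards [eventually_pt_mem hU hx] with u hu
  exact vecComp_grad hu.1 (hg.mdifferentiableAt hU hu.2) i

variable [IsContMDiffRiemannianBundle (𝓡 3) ∞ R3 (fun x : M ↦ TangentSpace (𝓡 3) x)]

lemma contDiffAt_vecComp_grad (hx : x ∈ U) (i : Fin 3) :
    ContDiffAt ℝ ∞ (vecComp (grad g) x i) (extChartAt (𝓡 3) x x) :=
  (ContDiffAt.sum fun j _ ↦ (contDiffAt_cometric (mem_extChartAt_target x) i j).mul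
    (contDiffAt_pderiv j (hg.contDiffAt hU hx))).congr_of_eventuallyEq
      (vecComp_grad_eventuallyEq hU hg hx i)

lemma smoothOn_act_grad {a : M → ℝ} (ha : SmoothOn a U) : SmoothOn (act (grad g) a) U := by
  intro x hx
  have h : ContDiffAt ℝ ∞ (act (grad g) a ∘ pt x) (extChartAt (𝓡 3) x x) := by
    refine (ContDiffAt.sum (s := Finset.univ) fun i _ ↦ (contDiffAt_vecComp_grad hU hg hx i).mul
      (contDiffAt_pderiv i (ha.contDiffAt hU hx))).congr_of_eventuallyEq ?_
    filter_upwards [eventually_pt_mem hU hx] with u hu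
    exact act_pt hu.1 _ (ha.mdifferentiableAt hU hu.2)
  have h2 := contMDiffAt_of_comp_pt (mem_extChartAt_target (I := 𝓡 3) x) h
  rw [pt_self] at h2
  exact h2.contMDiffWithinAt

lemma smoothOn_lieDeriv_grad (P : BivectorField M) {a b : M → ℝ} (ha : SmoothOn a U)
    (hb : SmoothOn b U) : SmoothOn (P.lieDeriv (grad g) a b) U :=
  ((smoothOn_act_grad hU hg (SmoothOn.bracket (P := P) hU ha hb)).sub
    (SmoothOn.bracket (P := P) hU (smoothOn_act_grad hU hg ha) hb)).sub
    (SmoothOn.bracket (P := P) hU ha (smoothOn_act_grad hU hg hb))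

lemma pderiv_vecComp_grad (hx : x ∈ U) (i k : Fin 3) :
    pderiv k (vecComp (grad g) x i) (extChartAt (𝓡 3) x x) =
      ∑ j, (pderiv k (cometric x i j) (extChartAt (𝓡 3) x x) *
          pgrad (g ∘ pt x) (extChartAt (𝓡 3) x x) j +
        cometric x i j (extChartAt (𝓡 3) x x) * phess (g ∘ pt x) (extChartAt (𝓡 3) x x) k j) := by
  have hc := fun j ↦ (contDiffAt_cometric (mem_extChartAt_target (I := 𝓡 3) x) i j).differentiableAt
    (by simp)
  have hd := fun j ↦ (contDiffAt_pderiv j (hg.contDiffAt hU hx)).differentiableAt (by simp)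
  rw [pderiv_congr k (vecComp_grad_eventuallyEq hU hg hx i)]
  simp only [Fin.sum_univ_three]
  simp (disch := fun_prop) only [pderiv_add, pderiv_mul]
  rfl

lemma obstruction_grad (o : ManifoldOrientation M) {f : M → ℝ} (hf : Smooth f) (hx : x ∈ U)
    (k : Fin 3) :
    pderiv k (fun w ↦ ∑ i, vecComp (grad g) x i w * pderiv i (f ∘ pt x) w)
        (extChartAt (𝓡 3) x x) -
      divVec (grad g) x * pderiv k (f ∘ pt x) (extChartAt (𝓡 3) x x) =
    obstruction (fun i j ↦ cometric x i j (extChartAt (𝓡 3) x x))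
      (fun l i j ↦ pderiv l (cometric x i j) (extChartAt (𝓡 3) x x))
      (fun i ↦ pderiv i (volComp o x) (extChartAt (𝓡 3) x x) / volComp o x (extChartAt (𝓡 3) x x))
      (pgrad (g ∘ pt x) (extChartAt (𝓡 3) x x)) (pgrad (f ∘ pt x) (extChartAt (𝓡 3) x x))
      (phess (g ∘ pt x) (extChartAt (𝓡 3) x x)) (phess (f ∘ pt x) (extChartAt (𝓡 3) x x)) k := by
  have ht := mem_extChartAt_target (I := 𝓡 3) x
  have hX := fun i ↦ (contDiffAt_vecComp_grad hU hg hx i).differentiableAt (by simp)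
  have hd := fun j ↦ (contDiffAt_pderiv j (contDiffAt_comp_pt ht (hf _))).differentiableAt (by simp)
  have hx0 := fun i ↦ (vecComp_grad_eventuallyEq hU hg hx i).self_of_nhds
  have h1 : pderiv k (fun w ↦ ∑ i, vecComp (grad g) x i w * pderiv i (f ∘ pt x) w)
        (extChartAt (𝓡 3) x x) = ∑ i, (pderiv k (vecComp (grad g) x i) (extChartAt (𝓡 3) x x) *
          pgrad (f ∘ pt x) (extChartAt (𝓡 3) x x) i +
        vecComp (grad g) x i (extChartAt (𝓡 3) x x) *
          phess (f ∘ pt x) (extChartAt (𝓡 3) x x) k i) := by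
    simp only [Fin.sum_univ_three]
    simp (disch := fun_prop) only [pderiv_add, pderiv_mul]
    rfl
  rw [h1, divVec_eq o]
  simp only [pderiv_vecComp_grad hU hg hx, hx0, obstruction, Fin.sum_univ_three, pgrad]
  ring

end Gradient

section Main

variable {M : Type*} [TopologicalSpace M] [ChartedSpace R3 M] [IsManifold (𝓡 3) ∞ M]
  [RiemannianBundle (fun x : M ↦ TangentSpace (𝓡 3) x)]
  {o : ManifoldOrientation M} {P : BivectorField M} {f : M → ℝ}

section

variable (hf : Smooth f) (hPf : ∀ x v, contractVolume o P x v = d f x v)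
include hf hPf

lemma isCasimirOn_univ : P.IsCasimirOn f univ := by
  intro x _ β
  have ht := mem_extChartAt_target (I := 𝓡 3) x
  have key : ∀ y, y = pt x (extChartAt (𝓡 3) x x) →
      ∀ β : TangentSpace (𝓡 3) y →L[ℝ] ℝ, P.eval y (d f y) β = 0 := by
    rintro _ rfl β
    rw [eval_eq_triple ht hf hPf]
    simp only [d_frame ht ((hf _).mdifferentiableAt (by simp)), triple, pgrad]
    ring
  exact key x (pt_self x).symm β

/-- The differential of a Casimir function is parallel to `df`. -/
lemma parallel_of_isCasimirOn {U : Set M} (hU : IsOpen U) {g : M → ℝ} (hg : SmoothOn g U)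
    (hc : P.IsCasimirOn g U) {p : M} {u : R3} (hu : u ∈ (extChartAt (𝓡 3) p).target)
    (huU : pt p u ∈ U) (i j : Fin 3) :
    pgrad (f ∘ pt p) u i * pgrad (g ∘ pt p) u j = pgrad (f ∘ pt p) u j * pgrad (g ∘ pt p) u i := by
  have h : ∀ k, triple (pgrad (f ∘ pt p) u) (pgrad (g ∘ pt p) u)
      (fun l ↦ if k = l then (1 : ℝ) else 0) = 0 := fun k ↦ by
    have h1 := hc _ huU (coframe p u k)
    rw [eval_eq_triple hu hf hPf] at h1
    simp only [d_frame hu (hg.mdifferentiableAt hU huU), coframe_frame hu] at h1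
    exact (mul_eq_zero.1 h1).resolve_left (inv_ne_zero (volComp_ne_zero o hu))
  have h0 := h 0
  have h1 := h 1
  have h2 := h 2
  simp [triple] at h0 h1 h2
  fin_cases i <;> fin_cases j <;> simp <;> linarith

end

variable [IsContMDiffRiemannianBundle (𝓡 3) ∞ R3 (fun x : M ↦ TangentSpace (𝓡 3) x)]

/-- The covector `d⟨df, df⟩ + Δ(f) df` in the coordinate frame. -/
lemma equation_iff (hf : Smooth f) (x : M) :
    d (fun y ↦ coInner (d f y) (d f y)) x + laplacian f x • d f x = 0 ↔
      ∀ k, pderiv k (fun w ↦ ∑ i, vecComp (grad f) x i w * pderiv i (f ∘ pt x) w)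
          (extChartAt (𝓡 3) x x) -
        divVec (grad f) x * pderiv k (f ∘ pt x) (extChartAt (𝓡 3) x x) = 0 := by
  have ht := mem_extChartAt_target (I := 𝓡 3) x
  have hU := isOpen_univ (X := M)
  have hf' : SmoothOn f univ := hf.contMDiffOn
  have hact : (fun y ↦ coInner (d f y) (d f y)) = act (grad f) f :=
    funext fun y ↦ coInner_eq_apply_sharp _ _
  have hpt : ∀ u ∈ (extChartAt (𝓡 3) x).target, act (grad f) f (pt x u) = _ := fun u hu ↦
    act_pt hu (grad f) (hf'.mdifferentiableAt hU (mem_univ _))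
  have hp : ∀ k, pderiv k (fun w ↦ ∑ i, vecComp (grad f) x i w * pderiv i (f ∘ pt x) w)
      (extChartAt (𝓡 3) x x) = pderiv k (act (grad f) f ∘ pt x) (extChartAt (𝓡 3) x x) := fun k ↦
    pderiv_congr k (Filter.eventually_of_mem (target_mem_nhds ht) fun u hu ↦ (hpt u hu).symm)
  have key : ∀ (c : ℝ) (y : M), y = pt x (extChartAt (𝓡 3) x x) →
      (d (act (grad f) f) y + (-c) • d f y = 0 ↔
        ∀ k, pderiv k (act (grad f) f ∘ pt x) (extChartAt (𝓡 3) x x) -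
          c * pderiv k (f ∘ pt x) (extChartAt (𝓡 3) x x) = 0) := by
    rintro c _ rfl
    have h1 := d_frame ht ((smoothOn_act_grad hU hf' hf').mdifferentiableAt hU (mem_univ _))
    have h2 := d_frame ht (hf'.mdifferentiableAt hU (mem_univ _))
    simp only [← h1, ← h2]
    constructor
    · intro h k
      have h3 := DFunLike.congr_fun h (frame x (extChartAt (𝓡 3) x x) k)
      change _ + -c * _ = (0 : ℝ) at h3
      linear_combination h3
    · intro h
      refine covector_ext ht fun k ↦ ?_
      change _ + -c * _ = (0 : ℝ)
      linear_combination h k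
  simp only [hact, hp]
  exact key _ x (pt_self x).symm

variable (hf : Smooth f) (hPf : ∀ x v, contractVolume o P x v = d f x v)
include hf hPf

lemma equation_of_isKillingPoisson (hP : IsKillingPoisson P) (x : M) :
    d (fun y ↦ coInner (d f y) (d f y)) x + laplacian f x • d f x = 0 := by
  rw [equation_iff hf]
  have ht := mem_extChartAt_target (I := 𝓡 3) x
  set U := (extChartAt (𝓡 3) x).source
  have hU : IsOpen U := isOpen_extChartAt_source x
  have hx : x ∈ U := mem_extChartAt_source x
  have hfU : SmoothOn f U := hf.contMDiffOn
  have hlie := hP.casimir U hU f hfU fun y _ ↦ isCasimirOn_univ hf hPf y (mem_univ y)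
  refine congrFun (f := fun k ↦ pderiv k (fun w ↦ ∑ i, vecComp (grad f) x i w *
    pderiv i (f ∘ pt x) w) (extChartAt (𝓡 3) x x) - divVec (grad f) x *
    pderiv k (f ∘ pt x) (extChartAt (𝓡 3) x x)) (eq_zero_of_triple_single fun i j ↦ ?_)
  have h := hlie _ _ (smoothOn_coord x i) (smoothOn_coord x j) x hx
  rw [lieDeriv_eq_triple hf hPf hU (smoothOn_coord x i) (smoothOn_coord x j) hx
    (contDiffAt_vecComp_grad hU hfU hx), pgrad_coord ht, pgrad_coord ht] at h
  exact (mul_eq_zero.1 h).resolve_left (inv_ne_zero (volComp_ne_zero o ht))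

lemma lieDeriv_eq_zero_of_d_ne_zero {U : Set M} (hU : IsOpen U) {g : M → ℝ} (hg : SmoothOn g U)
    (hc : P.IsCasimirOn g U) {a b : M → ℝ} (ha : SmoothOn a U) (hb : SmoothOn b U) {x : M}
    (hx : x ∈ U) (heq : d (fun y ↦ coInner (d f y) (d f y)) x + laplacian f x • d f x = 0)
    (hne : d f x ≠ 0) : P.lieDeriv (grad g) a b x = 0 := by
  have ht := mem_extChartAt_target (I := 𝓡 3) x
  have hF := contDiffAt_comp_pt ht (hf (pt x (extChartAt (𝓡 3) x x)))
  have hG := hg.contDiffAt hU hx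
  have hFd := fun i ↦ (contDiffAt_pderiv i hF).differentiableAt (by simp)
  have hGd := fun i ↦ (contDiffAt_pderiv i hG).differentiableAt (by simp)
  rw [equation_iff hf] at heq
  simp only [obstruction_grad isOpen_univ hf.contMDiffOn o hf (mem_univ x)] at heq
  obtain ⟨m, hm⟩ : ∃ m, pgrad (f ∘ pt x) (extChartAt (𝓡 3) x x) m ≠ 0 := by
    by_contra! h
    have key : ∀ y, y = pt x (extChartAt (𝓡 3) x x) → d f y = 0 := by
      rintro _ rfl
      refine covector_ext ht fun i ↦ ?_
      rw [d_frame ht ((hf _).mdifferentiableAt (by simp))]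
      exact h i
    exact hne (key x (pt_self x).symm)
  have hd : ∀ l i j, pderiv l (fun u ↦ pgrad (f ∘ pt x) u i * pgrad (g ∘ pt x) u j)
      (extChartAt (𝓡 3) x x) = pderiv l (fun u ↦ pgrad (f ∘ pt x) u j * pgrad (g ∘ pt x) u i)
      (extChartAt (𝓡 3) x x) := fun l i j ↦ by
    refine pderiv_congr l ?_
    filter_upwards [eventually_pt_mem hU hx] with u hu
    exact parallel_of_isCasimirOn hf hPf hU hg hc hu.1 hu.2 i j
  rw [lieDeriv_eq_triple hf hPf hU ha hb hx (contDiffAt_vecComp_grad hU hg hx)]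
  simp only [obstruction_grad hU hg o hf hx]
  rw [show obstruction _ _ _ _ _ _ _ = 0 from funext fun k ↦
    obstruction_eq_zero_of_parallel (phess_comm hG) (phess_comm hF)
      (parallel_of_isCasimirOn hf hPf hU hg hc ht (by rwa [pt_self])) (fun l i j ↦ ?_) hm heq k]
  · simp [triple]
  · have h := hd l i j
    simp only [pgrad] at h
    rw [pderiv_mul l (hFd i) (hGd j), pderiv_mul l (hFd j) (hGd i)] at h
    exact h

lemma lieDeriv_eq_zero_of_d_eventually_zero {U : Set M} (hU : IsOpen U) {g : M → ℝ}
    (hg : SmoothOn g U) {a b : M → ℝ} (ha : SmoothOn a U) (hb : SmoothOn b U) {x : M} (hx : x ∈ U)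
    (hz : ∀ᶠ y in 𝓝 x, d f y = 0) : P.lieDeriv (grad g) a b x = 0 := by
  have ht := mem_extChartAt_target (I := 𝓡 3) x
  have hc := continuousAt_pt ht
  rw [ContinuousAt, pt_self] at hc
  have h0 : ∀ᶠ u in 𝓝 (extChartAt (𝓡 3) x x), ∀ i, pderiv i (f ∘ pt x) u = 0 := by
    filter_upwards [target_mem_nhds ht, hc.eventually hz] with u hu hzu i
    rw [← d_frame hu ((hf _).mdifferentiableAt (by simp)), hzu]
    rfl
  rw [lieDeriv_eq_triple hf hPf hU ha hb hx (contDiffAt_vecComp_grad hU hg hx)]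
  have h1 : ∀ k, pderiv k (fun w ↦ ∑ i, vecComp (grad g) x i w * pderiv i (f ∘ pt x) w)
      (extChartAt (𝓡 3) x x) = 0 := fun k ↦ by
    rw [pderiv_congr k (G := fun _ ↦ 0)]
    · simp [pderiv]
    · filter_upwards [h0] with u hu
      simp [hu]
  simp only [h1, h0.self_of_nhds, mul_zero, sub_zero]
  simp [triple]

/-- The Lie derivative along the gradient of a Casimir function vanishes on the closure of
`{df ≠ 0}` by continuity, and elsewhere because `π` vanishes there. -/
lemma lieDerivVanishesOn_grad
    (heq : ∀ x, d (fun y ↦ coInner (d f y) (d f y)) x + laplacian f x • d f x = 0)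
    {U : Set M} (hU : IsOpen U) {g : M → ℝ} (hg : SmoothOn g U) (hc : P.IsCasimirOn g U) :
    P.LieDerivVanishesOn (grad g) U := by
  intro a b ha hb x hx
  by_cases hz : ∀ᶠ y in 𝓝 x, d f y = 0
  · exact lieDeriv_eq_zero_of_d_eventually_zero hf hPf hU hg ha hb hx hz
  · have hcont : ContinuousAt (P.lieDeriv (grad g) a b) x :=
      ((smoothOn_lieDeriv_grad hU hg P ha hb).contMDiffAt (hU.mem_nhds hx)).continuousAt
    by_contra hne
    refine hz ?_
    filter_upwards [hcont.eventually_ne hne, hU.mem_nhds hx] with y hy hyU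
    by_contra hdy
    exact hy (lieDeriv_eq_zero_of_d_ne_zero hf hPf hU hg hc ha hb hyU (heq y) hdy)

end Main

lemma isClosed_of_eq_d {M : Type*} [TopologicalSpace M] [ChartedSpace R3 M]
    [IsManifold (𝓡 3) ∞ M] {α : OneForm M} {f : M → ℝ} (hf : Smooth f) (h : ∀ x, α x = d f x) :
    α.IsClosed := by
  intro x v w
  have ht := mem_extChartAt_target (I := 𝓡 3) x
  have he : α.inChart x =ᶠ[𝓝 (extChartAt (𝓡 3) x x)] fderiv ℝ (f ∘ pt x) := by
    filter_upwards [target_mem_nhds ht] with u hu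
    ext w
    simp only [OneForm.inChart, h, ContinuousLinearMap.comp_apply]
    exact d_frameMap hu ((hf _).mdifferentiableAt (by simp)) w
  rw [OneForm.extDeriv, he.fderiv_eq, sub_eq_zero]
  exact (contDiffAt_comp_pt ht (hf _)).isSymmSndFDerivAt
    (by simpa using (WithTop.coe_le_coe.2 (le_top : (2 : ℕ∞) ≤ ⊤))) v w

end KillingPoisson

open KillingPoisson
theorem corollary5p1
    {M : Type*} [TopologicalSpace M] [T2Space M] [SecondCountableTopology M]
    [ChartedSpace R3 M] [IsManifold (𝓡 3) ∞ M]
    [RiemannianBundle (fun x : M ↦ TangentSpace (𝓡 3) x)]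
    [IsContMDiffRiemannianBundle (𝓡 3) ∞ R3 (fun x : M ↦ TangentSpace (𝓡 3) x)]
    (o : ManifoldOrientation M)
    (hH1 : FirstDeRhamVanishes M)
    (P : BivectorField M) :
    IsKillingPoisson P ↔
      ∃ f : M → ℝ, Smooth f ∧
        (∀ x v, contractVolume o P x v = d f x v) ∧
        (∀ x, d (fun y ↦ coInner (d f y) (d f y)) x + laplacian f x • d f x = 0) := by
  constructor
  · intro hP
    obtain ⟨f, hf, hPf⟩ := hH1 _ (contractForm_isSmooth o P)
      ((contractForm_isClosed_iff o P).2 hP.div_eq_zero)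
    have hPf' : ∀ x v, contractVolume o P x v = d f x v := fun x v ↦ by
      rw [← hPf x, contractForm_apply]
    exact ⟨f, hf, hPf', equation_of_isKillingPoisson hf hPf' hP⟩
  · rintro ⟨f, hf, hPf, heq⟩
    have hα : ∀ x, contractForm o P x = d f x := fun x ↦ by
      ext v
      rw [contractForm_apply, hPf]
    exact ⟨isPoisson_of_contractVolume_eq hf hPf,
      (contractForm_isClosed_iff o P).1 (isClosed_of_eq_d hf hα),
      fun U hU g hg hc ↦ lieDerivVanishesOn_grad hf hPf heq hU hg hc⟩
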